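/- Let $n,d\ge 0$ and let $M\subset\mathbb{C}^{N}$, $N=n+d$, be a generic real-analytic submanifold of CR dimension $n$ and real codimension $d$, i.e. near each of its points $M=\{\rho=0\}$ for a real-analytic map $\rho=(\rho_1,\dots,\rho_d)$ with values in $\mathbb{R}^d$ such that $\partial\rho_1,\dots,\partial\rho_d$ are linearly independent over $\mathbb{C}$. Let $p\in M$ and let $\mathbb{C}\{M\}_p$ be the ring of germs at $p$ of complex-valued real-analytic functions on $M$. A CR vector field on $M$ near $p$ is a vector field $L=\sum_{k=1}^{N}a_k\,\partial/\partial\bar z_k$ with coefficients $a_k$ that are real-analytic near $p$ and which is tangent to $M$, i.e. $L\rho_j=0$ on $M$ near $p$ for $j=1,\dots,d$. Let $I\subset\mathbb{C}\{M\}_p$ be an ideal which is $\bar\partial_b$-closed, i.e. $Lf\in I$ for every germ at $p$ of a CR vector field $L$ on $M$ and every $f\in I$. Let $\mathcal{V}(I)$ denote the germ at $p$ of the real-analytic subset of $M$ given by the vanishing of all elements of $I$; that is, the largest germ at $p$ of a subset of $M$ on which (the germ of) every $f\in I$ vanishes (if $f_1,\dots,f_m$ generate $I$, it is the germ of $\{f_1=\dots=f_m=0\}\subset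 M$). Then there exist an open neighborhood $U$ of $p$ in $\mathbb{C}^N$ and a complex analytic subvariety $V\subset U$ (near each point of $U$ the common zero set of finitely many holomorphic functions) such that $V\cap M=\mathcal{V}(I)$ in the sense of germs at $p$. In particular the germ $\mathcal{V}(I)$ exists. -/

import Mathlib

open Filter Topology

noncomputable section

namespace CRGerm

/-- The Wirtinger derivative `∂F/∂z_k = (∂F/∂x_k - i ∂F/∂y_k) / 2` on `ℂ^N`. -/
def dz {N : ℕ} (k : Fin N) (F : (Fin N → ℂ) → ℂ) (q : Fin N → ℂ) : ℂ :=
  (1 / 2 : ℂ) * (fderiv ℝ F q (Pi.single k 1) - Complex.I * fderiv ℝ F q (Pi.single k Complex.I))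

/-- The Wirtinger derivative `∂F/∂z̄_k = (∂F/∂x_k + i ∂F/∂y_k) / 2` on `ℂ^N`. -/
def dzbar {N : ℕ} (k : Fin N) (F : (Fin N → ℂ) → ℂ) (q : Fin N → ℂ) : ℂ :=
  (1 / 2 : ℂ) * (fderiv ℝ F q (Pi.single k 1) + Complex.I * fderiv ℝ F q (Pi.single k Complex.I))

/-- `ρ = (ρ_1, …, ρ_d)` is a real-analytic real-valued defining map of `M` near `p` whose complex
differentials `∂ρ_1, …, ∂ρ_d` are linearly independent over `ℂ` at `p` (hence near `p`; in
particular the real differentials are linearly independent). -/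
structure IsGenericDefiningMapAt {N d : ℕ} (M : Set (Fin N → ℂ)) (p : Fin N → ℂ)
    (ρ : (Fin N → ℂ) → Fin d → ℝ) : Prop where
  analyticAt : AnalyticAt ℝ ρ p
  mem_iff : ∀ᶠ q in 𝓝 p, q ∈ M ↔ ρ q = 0
  linearIndependent :
    LinearIndependent ℂ (fun (j : Fin d) (k : Fin N) => dz k (fun q => ((ρ q j : ℝ) : ℂ)) p)

/-- `M` is a generic real-analytic (embedded) submanifold of `ℂ^N` of real codimension `d`. -/
def IsGenericSubmanifold {N : ℕ} (d : ℕ) (M : Set (Fin N → ℂ)) : Prop :=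
  ∀ p ∈ M, ∃ ρ : (Fin N → ℂ) → Fin d → ℝ, IsGenericDefiningMapAt M p ρ

/-- The ring `ℂ{M}_p` of germs at `p` of complex-valued real-analytic functions on `M`: the germs
along `M` of restrictions of functions that are real-analytic near `p` in `ℂ^N`. -/
def analyticGerms {N : ℕ} (M : Set (Fin N → ℂ)) (p : Fin N → ℂ) :
    Subring (Germ (𝓝[M] p) ℂ) where
  carrier := {g | ∃ F : (Fin N → ℂ) → ℂ, AnalyticAt ℝ F p ∧ (F : Germ (𝓝[M] p) ℂ) = g}
  mul_mem' := by
    rintro _ _ ⟨F, hF, rfl⟩ ⟨G, hG, rfl⟩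
    exact ⟨F * G, hF.mul hG, rfl⟩
  one_mem' := ⟨1, analyticAt_const, rfl⟩
  add_mem' := by
    rintro _ _ ⟨F, hF, rfl⟩ ⟨G, hG, rfl⟩
    exact ⟨F + G, hF.add hG, rfl⟩
  zero_mem' := ⟨0, analyticAt_const, rfl⟩
  neg_mem' := by
    rintro _ ⟨F, hF, rfl⟩
    exact ⟨-F, hF.neg, rfl⟩

/-- The germ along `M` at `p` of a function that is real-analytic near `p`. -/
def restrict {N : ℕ} (M : Set (Fin N → ℂ)) {p : Fin N → ℂ} (F : (Fin N → ℂ) → ℂ)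
    (hF : AnalyticAt ℝ F p) : analyticGerms M p :=
  ⟨(F : Germ (𝓝[M] p) ℂ), F, hF, rfl⟩

/-- The operator `F ↦ ∑ a_k ∂F/∂z̄_k`. -/
def applyField {N : ℕ} (a : (Fin N → ℂ) → Fin N → ℂ) (F : (Fin N → ℂ) → ℂ)
    (q : Fin N → ℂ) : ℂ :=
  ∑ k, a q k * dzbar k F q

theorem analyticAt_applyField {N : ℕ} {p : Fin N → ℂ} {a : (Fin N → ℂ) → Fin N → ℂ}
    {F : (Fin N → ℂ) → ℂ} (ha : AnalyticAt ℝ a p) (hF : AnalyticAt ℝ F p) :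
    AnalyticAt ℝ (applyField a F) p := by
  have hd : ∀ v : Fin N → ℂ, AnalyticAt ℝ (fun q => fderiv ℝ F q v) p := fun v =>
    ((ContinuousLinearMap.apply ℝ ℂ v).analyticAt _).comp hF.fderiv
  have hk : ∀ k : Fin N, AnalyticAt ℝ (fun q => a q k * dzbar k F q) p := fun k =>
    (analyticAt_pi_iff.1 ha k).mul
      (analyticAt_const.mul ((hd _).add (analyticAt_const.mul (hd _))))
  exact Finset.univ.analyticAt_fun_sum fun k _ => hk k

/-- `L = ∑ a_k ∂/∂z̄_k` is (the germ at `p` of) a real-analytic CR vector field on `M`, where `M` is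
generic of codimension `d`: at the points of `M` near `p` the `(0,1)`-vector `L` is tangent to `M`,
i.e. it annihilates a defining map of `M`. -/
def IsCRVectorFieldAt {N : ℕ} (d : ℕ) (M : Set (Fin N → ℂ)) (p : Fin N → ℂ)
    (a : (Fin N → ℂ) → Fin N → ℂ) : Prop :=
  AnalyticAt ℝ a p ∧ ∃ ρ : (Fin N → ℂ) → Fin d → ℝ, IsGenericDefiningMapAt M p ρ ∧
    ∀ᶠ q in 𝓝[M] p, ∀ j, applyField a (fun q => ((ρ q j : ℝ) : ℂ)) q = 0

/-- The ideal `I` is `∂̄_b`-closed: `L f ∈ I` for each CR vector field `L` and each `f ∈ I`. Here `L f`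
is computed from a real-analytic extension `F` of `f`; as `L` is tangent to `M`, its germ along `M`
does not depend on the extension. -/
def IsDbarClosed {N : ℕ} (d : ℕ) {M : Set (Fin N → ℂ)} {p : Fin N → ℂ}
    (I : Ideal (analyticGerms M p)) : Prop :=
  ∀ (a : (Fin N → ℂ) → Fin N → ℂ) (ha : IsCRVectorFieldAt d M p a)
    (F : (Fin N → ℂ) → ℂ) (hF : AnalyticAt ℝ F p),
    restrict M F hF ∈ I → restrict M (applyField a F) (analyticAt_applyField ha.1 hF) ∈ I

/-- The germ at `p` of the set `A` is contained in `M`, and every element of `I` vanishes on it. -/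
def VanishesOn {N : ℕ} {M : Set (Fin N → ℂ)} {p : Fin N → ℂ}
    (I : Ideal (analyticGerms M p)) (A : Set (Fin N → ℂ)) : Prop :=
  (∀ᶠ q in 𝓝 p, q ∈ A → q ∈ M) ∧
    ∀ (F : (Fin N → ℂ) → ℂ) (hF : AnalyticAt ℝ F p), restrict M F hF ∈ I →
      ∀ᶠ q in 𝓝 p, q ∈ A → F q = 0

/-- The germ at `p` of the set `A` is the zero set germ `𝒱(I)`: it is the intersection (greatest
lower bound in the ordered set of germs of sets) of the germs of `{f = 0} ⊆ M`, `f ∈ I`.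
For `f_1, …, f_m` generating `I` this is the germ of `{f_1 = ⋯ = f_m = 0}`, see
`isZeroLocus_of_span`. -/
def IsZeroLocus {N : ℕ} {M : Set (Fin N → ℂ)} {p : Fin N → ℂ}
    (I : Ideal (analyticGerms M p)) (A : Set (Fin N → ℂ)) : Prop :=
  VanishesOn I A ∧
    ∀ B : Set (Fin N → ℂ), VanishesOn I B → ∀ᶠ q in 𝓝 p, q ∈ B → q ∈ A

/-- The zero set germ of a finitely generated ideal is the germ of the common zero set of
representatives of the generators. -/
theorem isZeroLocus_of_span {N m : ℕ} {M : Set (Fin N → ℂ)} {p : Fin N → ℂ}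
    (F : Fin m → (Fin N → ℂ) → ℂ) (hF : ∀ i, AnalyticAt ℝ (F i) p) :
    IsZeroLocus (Ideal.span (Set.range fun i => restrict M (F i) (hF i)))
      {q | q ∈ M ∧ ∀ i, F i q = 0} := by
  refine ⟨⟨Eventually.of_forall fun q hq => hq.1, ?_⟩, ?_⟩
  · intro G hG hGI
    obtain ⟨c, hc⟩ := (Ideal.mem_span_range_iff_exists_fun).1 hGI
    choose C hC hCc using fun i => (c i).2
    have h : ((∑ i, C i * F i : (Fin N → ℂ) → ℂ) : Germ (𝓝[M] p) ℂ) = (G : Germ (𝓝[M] p) ℂ) := by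
      have h1 := congrArg (Subtype.val) hc
      simp only [AddSubmonoidClass.coe_finsetSum] at h1
      change _ = (G : Germ (𝓝[M] p) ℂ) at h1
      rw [← h1]
      have h2 := map_sum (Germ.coeRingHom (R := ℂ) (𝓝[M] p)) (fun i => C i * F i) Finset.univ
      refine h2.trans (Finset.sum_congr rfl fun i _ => ?_)
      rw [map_mul]
      change (C i : Germ (𝓝[M] p) ℂ) * (F i : Germ (𝓝[M] p) ℂ) = _
      rw [hCc]
      rfl
    have h3 := eventually_nhdsWithin_iff.1 (Germ.coe_eq.1 h)
    filter_upwards [h3] with q hq hqA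
    rw [← hq hqA.1]
    simp [Finset.sum_apply, hqA.2]
  · rintro B ⟨hBM, hB⟩
    have h : ∀ᶠ q in 𝓝 p, ∀ i, q ∈ B → F i q = 0 :=
      eventually_all.2 fun i => hB (F i) (hF i) (Ideal.subset_span ⟨i, rfl⟩)
    filter_upwards [hBM, h] with q h1 h2 hq
    exact ⟨h1 hq, fun i => h2 i hq⟩

/-- `V` is a complex analytic subvariety of the open set `U`: near each point of `U` it is the common
zero set of finitely many holomorphic functions (in particular `V` is closed in `U`). -/
def IsComplexSubvariety {N : ℕ} (U V : Set (Fin N → ℂ)) : Prop :=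
  V ⊆ U ∧ ∀ q ∈ U, ∃ (m : ℕ) (h : Fin m → (Fin N → ℂ) → ℂ), (∀ i, AnalyticAt ℂ (h i) q) ∧
    ∀ᶠ z in 𝓝 q, z ∈ V ↔ ∀ i, h i z = 0

end CRGerm

end

/-! Make the real and imaginary parts of `q - p` independent complex variables. Real-analytic germs
at `p` become convergent power series in `2N` variables (`exists_evalSeries_complexify`), and `ρ`
becomes a holomorphic map `R` that vanishes on the image of `M` near the origin. Let `Z` be the
complex linear map with `Z = q - p` on the image of `q` (`holomorphicCoord`). By genericity the
`∂̄ρ_j` are independent, so `(Z, R)` is a submersion (`IsGenericDefiningMapAt.range_eq_top`) and a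
chart `Φ` straightens its fibres. Holomorphic vector fields along these fibres restrict to CR vector
fields on `M` (`isCRVectorFieldAt_of_tangent`).

The preimage of `I` in the ring of convergent power series is generated by finitely many `g_i`
(`isNoetherianRing_convergent`). As `I` is `∂̄_b`-closed, the derivative of each `g_i` along such a
field is a combination of the `g_j`, on a full neighbourhood in the complexification and not only
over `M` (`eventually_fderiv_eq_sum`). By Grönwall's inequality the common zeros of the `g_i`
therefore spread along the fibres (`exists_convex_nhds_zero_iff`). A point `q` of `M` lies in the
fibre over `(q - p, 0)`; so `q` is in the zero locus iff the `g_i` vanish at the point `Φ.symm ((q -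
p, 0), 0)` of the same fibre. That point depends holomorphically on `q`, and the resulting equations
define `V`.

Noetherianity comes from division with remainder. Order the monomials by a positive linear form `μ`
that is injective on exponents. On polydiscs with radii `exp (-t * μ i)`, `t` large, the initial
monomial dominates the rest of the series, so division is a Neumann series (`exists_division`).
Dickson's lemma leaves finitely many minimal initial exponents. -/

open scoped ENNReal

noncomputable section

namespace CRGerm

/-! ### Weighted `ℓ¹`-norms of power series -/

section

open MvPowerSeries

variable {σ : Type*} [Fintype σ]

/-- The linear form `α ↦ ∑ i, l i * α i` on exponents. -/
def pairing (l : σ → ℝ) (α : σ →₀ ℕ) : ℝ := ∑ i, l i * α i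

/-- The value of the monomial `z ^ α` at the point with coordinates `exp (-l i)`. -/
def expWeight (l : σ → ℝ) (α : σ →₀ ℕ) : ℝ≥0∞ := ENNReal.ofReal (Real.exp (-pairing l α))

/-- The weighted `ℓ¹`-norm of a power series on the polydisc with radii `exp (-l i)`. -/
def weightedNorm (l : σ → ℝ) (a : MvPowerSeries σ ℂ) : ℝ≥0∞ :=
  ∑' α, ‖coeff α a‖ₑ * expWeight l α

theorem pairing_add (l : σ → ℝ) (α β : σ →₀ ℕ) :
    pairing l (α + β) = pairing l α + pairing l β := by
  simp [pairing, mul_add, Finset.sum_add_distrib]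

theorem pairing_zero (l : σ → ℝ) : pairing l 0 = 0 := by simp [pairing]

theorem pairing_smul (t : ℝ) (l : σ → ℝ) (α : σ →₀ ℕ) :
    pairing (t • l) α = t * pairing l α := by
  simp [pairing, Finset.mul_sum, mul_assoc]

theorem expWeight_add (l : σ → ℝ) (α β : σ →₀ ℕ) :
    expWeight l (α + β) = expWeight l α * expWeight l β := by
  rw [expWeight, pairing_add, neg_add, Real.exp_add, ENNReal.ofReal_mul (Real.exp_pos _).le]
  rfl

theorem expWeight_zero (l : σ → ℝ) : expWeight l 0 = 1 := by
  simp [expWeight, pairing_zero]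

theorem expWeight_ne_zero (l : σ → ℝ) (α : σ →₀ ℕ) : expWeight l α ≠ 0 := by
  simp [expWeight, Real.exp_pos]

theorem expWeight_ne_top (l : σ → ℝ) (α : σ →₀ ℕ) : expWeight l α ≠ ∞ := by
  simp [expWeight]

theorem expWeight_anti {l l' : σ → ℝ} (h : l ≤ l') (α : σ →₀ ℕ) :
    expWeight l' α ≤ expWeight l α := by
  refine ENNReal.ofReal_le_ofReal (Real.exp_le_exp.2 (neg_le_neg ?_))
  exact Finset.sum_le_sum fun i _ => mul_le_mul_of_nonneg_right (h i) (Nat.cast_nonneg _)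

theorem weightedNorm_anti {l l' : σ → ℝ} (h : l ≤ l') (a : MvPowerSeries σ ℂ) :
    weightedNorm l' a ≤ weightedNorm l a :=
  ENNReal.tsum_le_tsum fun α => by gcongr; exact expWeight_anti h α

theorem weightedNorm_add_le (l : σ → ℝ) (a b : MvPowerSeries σ ℂ) :
    weightedNorm l (a + b) ≤ weightedNorm l a + weightedNorm l b := by
  rw [weightedNorm, weightedNorm, weightedNorm, ← ENNReal.tsum_add]
  refine ENNReal.tsum_le_tsum fun α => ?_
  rw [← add_mul, map_add]
  gcongr
  exact enorm_add_le _ _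

theorem weightedNorm_zero (l : σ → ℝ) : weightedNorm l 0 = 0 := by simp [weightedNorm]

theorem weightedNorm_neg (l : σ → ℝ) (a : MvPowerSeries σ ℂ) :
    weightedNorm l (-a) = weightedNorm l a := by simp [weightedNorm]

theorem weightedNorm_sum_le {ι : Type*} (s : Finset ι) (l : σ → ℝ) (a : ι → MvPowerSeries σ ℂ) :
    weightedNorm l (∑ i ∈ s, a i) ≤ ∑ i ∈ s, weightedNorm l (a i) :=
  Finset.le_sum_of_subadditive _ (weightedNorm_zero l).le (weightedNorm_add_le l) s a

theorem eq_zero_of_weightedNorm_eq_zero {l : σ → ℝ} {a : MvPowerSeries σ ℂ}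
    (h : weightedNorm l a = 0) : a = 0 := by
  ext α
  simpa [expWeight_ne_zero] using ENNReal.tsum_eq_zero.1 h α

theorem weightedNorm_monomial (l : σ → ℝ) (α : σ →₀ ℕ) (c : ℂ) :
    weightedNorm l (monomial α c) = ‖c‖ₑ * expWeight l α := by
  classical
  rw [weightedNorm, tsum_eq_single α]
  · simp
  · intro β hβ
    simp [coeff_monomial, hβ]

/-- The weights are multiplicative, so the double sum over pairs of exponents can be regrouped along
antidiagonals. -/
theorem weightedNorm_mul_le (l : σ → ℝ) (a b : MvPowerSeries σ ℂ) :
    weightedNorm l (a * b) ≤ weightedNorm l a * weightedNorm l b := by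
  classical
  calc weightedNorm l (a * b)
      ≤ ∑' γ, ∑ x : Finset.HasAntidiagonal.antidiagonal γ, (‖coeff x.1.1 a‖ₑ * expWeight l x.1.1) *
          (‖coeff x.1.2 b‖ₑ * expWeight l x.1.2) := by
        refine ENNReal.tsum_le_tsum fun γ => ?_
        rw [coeff_mul, Finset.sum_coe_sort (Finset.HasAntidiagonal.antidiagonal γ) fun x =>
          (‖coeff x.1 a‖ₑ * expWeight l x.1) * (‖coeff x.2 b‖ₑ * expWeight l x.2)]
        refine (mul_le_mul_left (enorm_sum_le _ _) _).trans ?_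
        rw [Finset.sum_mul]
        refine Finset.sum_le_sum fun x hx => ?_
        rw [← Finset.HasAntidiagonal.mem_antidiagonal.1 hx, expWeight_add, enorm_mul]
        exact (mul_mul_mul_comm _ _ _ _).le
    _ = ∑' x : (Σ γ : σ →₀ ℕ, Finset.HasAntidiagonal.antidiagonal γ),
          (‖coeff x.2.1.1 a‖ₑ * expWeight l x.2.1.1) *
          (‖coeff x.2.1.2 b‖ₑ * expWeight l x.2.1.2) := by
        rw [ENNReal.tsum_sigma']
        exact tsum_congr fun γ => (tsum_fintype _).symm
    _ = ∑' x : (σ →₀ ℕ) × (σ →₀ ℕ), (‖coeff x.1 a‖ₑ * expWeight l x.1) *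
          (‖coeff x.2 b‖ₑ * expWeight l x.2) :=
        Finset.HasAntidiagonal.sigmaAntidiagonalEquivProd.tsum_eq fun x : (σ →₀ ℕ) × (σ →₀ ℕ) =>
          (‖coeff x.1 a‖ₑ * expWeight l x.1) * (‖coeff x.2 b‖ₑ * expWeight l x.2)
    _ = weightedNorm l a * weightedNorm l b := by
        rw [ENNReal.tsum_prod', weightedNorm, weightedNorm, ← ENNReal.tsum_mul_right]
        exact tsum_congr fun α => by rw [← ENNReal.tsum_mul_left]

/-- Power series that converge on some polydisc around the origin. -/
def convergent (σ : Type*) [Fintype σ] : Subring (MvPowerSeries σ ℂ) where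
  carrier := {a | ∃ l : σ → ℝ, weightedNorm l a < ∞}
  mul_mem' := by
    rintro a b ⟨l, hl⟩ ⟨l', hl'⟩
    -- A larger `l` means smaller radii: the supremum is the intersection of the two polydiscs.
    refine ⟨l ⊔ l', (weightedNorm_mul_le _ _ _).trans_lt (ENNReal.mul_lt_top ?_ ?_)⟩
    · exact (weightedNorm_anti le_sup_left a).trans_lt hl
    · exact (weightedNorm_anti le_sup_right b).trans_lt hl'
  one_mem' := ⟨0, by
    rw [← monomial_zero_one, weightedNorm_monomial]
    simp [expWeight_zero]⟩
  add_mem' := by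
    rintro a b ⟨l, hl⟩ ⟨l', hl'⟩
    refine ⟨l ⊔ l', (weightedNorm_add_le _ _ _).trans_lt (ENNReal.add_lt_top.2 ⟨?_, ?_⟩)⟩
    · exact (weightedNorm_anti le_sup_left a).trans_lt hl
    · exact (weightedNorm_anti le_sup_right b).trans_lt hl'
  zero_mem' := ⟨0, by simp [weightedNorm_zero]⟩
  neg_mem' := by
    rintro a ⟨l, hl⟩
    exact ⟨l, by rwa [weightedNorm_neg]⟩

/-- A weighted `ℓ¹`-contraction has a geometric series. -/
theorem exists_eq_add_of_contraction (l : σ → ℝ) (S : MvPowerSeries σ ℂ →+ MvPowerSeries σ ℂ)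
    (hS : ∀ e, weightedNorm l (S e) ≤ 2⁻¹ * weightedNorm l e) {g : MvPowerSeries σ ℂ}
    (hg : weightedNorm l g < ∞) : ∃ e, weightedNorm l e < ∞ ∧ e = g + S e := by
  have hpow : ∀ m, weightedNorm l (S^[m] g) ≤ 2⁻¹ ^ m * weightedNorm l g := by
    intro m
    induction m with
    | zero => simp
    | succ m ih =>
      rw [Function.iterate_succ_apply', pow_succ', mul_assoc]
      exact (hS _).trans (by gcongr)
  have htail : ∀ M, ∑' m, weightedNorm l (S^[m + M] g) ≤ 2⁻¹ ^ M * (2 * weightedNorm l g) := by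
    intro M
    calc ∑' m, weightedNorm l (S^[m + M] g)
        ≤ ∑' m : ℕ, 2⁻¹ ^ m * (2⁻¹ ^ M * weightedNorm l g) :=
          ENNReal.tsum_le_tsum fun m => by rw [← mul_assoc, ← pow_add]; exact hpow _
      _ = 2⁻¹ ^ M * (2 * weightedNorm l g) := by
          rw [ENNReal.tsum_mul_right, ENNReal.tsum_geometric, ENNReal.one_sub_inv_two, inv_inv]
          ring
  have hswap : ∀ M, ∑' α, (∑' m, ‖coeff α (S^[m + M] g)‖ₑ) * expWeight l α
      ≤ 2⁻¹ ^ M * (2 * weightedNorm l g) := by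
    intro M
    refine le_trans (le_of_eq ?_) (htail M)
    simp_rw [← ENNReal.tsum_mul_right]
    exact ENNReal.tsum_comm
  have hsum : ∀ α, Summable fun m => coeff α (S^[m] g) := by
    intro α
    refine Summable.of_enorm (ne_of_lt ?_)
    have h1 := (ENNReal.le_tsum α).trans (hswap 0)
    have h2 := h1.trans_lt (ENNReal.mul_lt_top (by simp) (ENNReal.mul_lt_top (by simp) hg))
    exact ENNReal.lt_top_of_mul_ne_top_left h2.ne (expWeight_ne_zero l α)
  -- The Neumann series, summed coefficient by coefficient; `hdiff` then gives its convergence in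
  -- norm.
  let e : MvPowerSeries σ ℂ := fun α => ∑' m, coeff α (S^[m] g)
  have hdiff : ∀ M, weightedNorm l (e - ∑ m ∈ Finset.range M, S^[m] g)
      ≤ 2⁻¹ ^ M * (2 * weightedNorm l g) := by
    intro M
    refine le_trans (ENNReal.tsum_le_tsum fun α => ?_) (hswap M)
    have : coeff α (e - ∑ m ∈ Finset.range M, S^[m] g) = ∑' m, coeff α (S^[m + M] g) := by
      rw [map_sub, map_sum, sub_eq_iff_eq_add', (hsum α).sum_add_tsum_nat_add]
      rfl
    rw [this]
    gcongr
    exact enorm_tsum_le_tsum_enorm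
  have hfin : 2 * weightedNorm l g < ∞ := ENNReal.mul_lt_top (by simp) hg
  refine ⟨e, ?_, ?_⟩
  · have := hdiff 0
    simp only [Finset.range_zero, Finset.sum_empty, sub_zero, pow_zero, one_mul] at this
    exact this.trans_lt hfin
  · rw [← sub_eq_zero]
    apply eq_zero_of_weightedNorm_eq_zero (l := l)
    -- The error is one tail of the series minus `S` applied to the preceding tail, and both tend to
    -- zero.
    have key : ∀ M, weightedNorm l (e - (g + S e)) ≤ 2⁻¹ ^ M * (2 * (2 * weightedNorm l g)) := by
      intro M
      have h1 : e - (g + S e) = (e - ∑ m ∈ Finset.range (M + 1), S^[m] g) +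
          -S (e - ∑ m ∈ Finset.range M, S^[m] g) := by
        rw [Finset.sum_range_succ', map_sub, map_sum]
        simp only [Function.iterate_succ_apply', Function.iterate_zero_apply]
        abel
      rw [h1]
      refine (weightedNorm_add_le _ _ _).trans ?_
      rw [weightedNorm_neg]
      calc _ ≤ 2⁻¹ ^ (M + 1) * (2 * weightedNorm l g) +
            2⁻¹ * (2⁻¹ ^ M * (2 * weightedNorm l g)) :=
            add_le_add (hdiff _) ((hS _).trans (by gcongr; exact hdiff M))
        _ = 2⁻¹ ^ M * (2 * weightedNorm l g) * (2⁻¹ + 2⁻¹) := by ring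
        _ ≤ _ := by
          rw [ENNReal.inv_two_add_inv_two, mul_one]
          gcongr
          exact le_mul_of_one_le_left (by simp) (by norm_num)
    have hlim : Tendsto (fun M : ℕ => (2⁻¹ : ℝ≥0∞) ^ M * (2 * (2 * weightedNorm l g))) atTop
        (𝓝 (0 * (2 * (2 * weightedNorm l g)))) :=
      ENNReal.Tendsto.mul_const
        (ENNReal.tendsto_pow_atTop_nhds_zero_of_lt_one (by simp))
        (Or.inr (ENNReal.mul_lt_top (by simp) hfin).ne)
    rw [zero_mul] at hlim
    exact le_antisymm (ge_of_tendsto' hlim key) (by simp)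

end

/-! ### Division with remainder and Noetherianity -/

section

open MvPowerSeries

variable {σ : Type*} [Fintype σ]

/-- Rationally independent reals exist in any finite number, because `ℝ` has infinite dimension over
`ℚ`; replacing them by their absolute values preserves independence. The form then orders the
monomials totally and additively. -/
theorem exists_pairing_injective (σ : Type*) [Fintype σ] :
    ∃ μ : σ → ℝ, (∀ i, 0 < μ i) ∧ Function.Injective (pairing μ) := by
  obtain ⟨f, hf⟩ := exists_linearIndependent_of_le_rank (R := ℚ) (M := ℝ) (n := Fintype.card σ)
    (by rw [Real.rank_rat_real]; exact (Cardinal.nat_lt_continuum _).le)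
  have hg : LinearIndependent ℚ (f ∘ Fintype.equivFin σ) := hf.comp _ (Fintype.equivFin σ).injective
  refine ⟨fun i => |f (Fintype.equivFin σ i)|, fun i => abs_pos.2 (hg.ne_zero i), ?_⟩
  intro α β h
  -- The sign is rational, so it can be moved into the coefficients of the linear relation.
  have hs : ∀ x : ℝ, |x| = x * (if 0 ≤ x then (1 : ℚ) else -1 : ℚ) := by
    intro x
    split_ifs with hx
    · simp [abs_of_nonneg hx]
    · simp [abs_of_neg (not_le.1 hx)]
  have h0 : ∑ i, ((if 0 ≤ f (Fintype.equivFin σ i) then (1 : ℚ) else -1) * ((α i : ℚ) - β i)) •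
      (f ∘ Fintype.equivFin σ) i = 0 := by
    rw [pairing, pairing, ← sub_eq_zero, ← Finset.sum_sub_distrib] at h
    refine Eq.trans (Finset.sum_congr rfl fun i _ => ?_) h
    rw [hs, Rat.smul_def, Function.comp_apply]
    push_cast
    ring
  ext i
  have h1 := Fintype.linearIndependent_iff.1 hg _ h0 i
  have h2 : (α i : ℚ) - β i = 0 := by
    rcases mul_eq_zero.1 h1 with h2 | h2
    · split_ifs at h2 <;> norm_num at h2
    · exact h2
  exact_mod_cast sub_eq_zero.1 h2

/-- Positivity of `μ` bounds every coordinate by `c / μ i`. Hence nonempty sets of exponents have a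
least value of the form. -/
theorem finite_pairing_le {μ : σ → ℝ} (hμ : ∀ i, 0 < μ i) (c : ℝ) :
    {α : σ →₀ ℕ | pairing μ α ≤ c}.Finite := by
  classical
  refine (Set.finite_Iic (Finsupp.equivFunOnFinite.symm fun i => ⌊c / μ i⌋₊)).subset ?_
  intro α hα i
  refine Nat.le_floor ((le_div_iff₀ (hμ i)).2 ?_)
  refine le_trans ?_ hα
  rw [mul_comm]
  exact Finset.single_le_sum (f := fun i => μ i * (α i : ℝ))
    (fun i _ => mul_nonneg (hμ i).le (Nat.cast_nonneg _)) (Finset.mem_univ i)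

theorem exists_pairing_minimal {μ : σ → ℝ} (hμ : ∀ i, 0 < μ i) {S : Set (σ →₀ ℕ)}
    (hS : S.Nonempty) : ∃ α ∈ S, ∀ β ∈ S, pairing μ α ≤ pairing μ β := by
  obtain ⟨γ, hγ⟩ := hS
  have hfin : (S ∩ {α | pairing μ α ≤ pairing μ γ}).Finite :=
    (finite_pairing_le hμ _).inter_of_right _
  obtain ⟨α, hα, hmin⟩ := Set.exists_min_image _ (pairing μ) hfin ⟨γ, hγ, le_refl (pairing μ γ)⟩
  refine ⟨α, hα.1, fun β hβ => ?_⟩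
  by_cases h : pairing μ β ≤ pairing μ γ
  · exact hmin β ⟨hβ, h⟩
  · exact hα.2.trans (not_le.1 h).le

/-- `α` is the initial exponent of `f` for the order given by `μ`, and has coefficient one. -/
def IsMonicAt (μ : σ → ℝ) (α : σ →₀ ℕ) (f : MvPowerSeries σ ℂ) : Prop :=
  coeff α f = 1 ∧ ∀ β ≠ α, coeff β f ≠ 0 → pairing μ α < pairing μ β

theorem expWeight_smul_le {μ : σ → ℝ} {t₀ t : ℝ} (ht : t₀ ≤ t) {c : ℝ} {β : σ →₀ ℕ}
    (hc : c ≤ pairing μ β) :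
    expWeight (t • μ) β ≤ ENNReal.ofReal (Real.exp (-(t - t₀) * c)) * expWeight (t₀ • μ) β := by
  rw [expWeight, expWeight, ← ENNReal.ofReal_mul (Real.exp_pos _).le, ← Real.exp_add,
    pairing_smul, pairing_smul]
  refine ENNReal.ofReal_le_ofReal (Real.exp_le_exp.2 ?_)
  nlinarith

theorem exists_smul_ge {μ : σ → ℝ} (hμ : ∀ i, 0 < μ i) (l : σ → ℝ) :
    ∀ᶠ t : ℝ in atTop, l ≤ t • μ := by
  refine (eventually_all.2 fun i => ?_ : ∀ᶠ t : ℝ in atTop, ∀ i, l i ≤ (t • μ) i)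
  filter_upwards [eventually_ge_atTop (l i / μ i)] with t ht
  exact (div_le_iff₀ (hμ i)).1 ht

/-- The values of the form on the other exponents of `f` exceed that on `α` by a fixed gap `δ`.
Increasing `t` from `t₀` thus shrinks the rest of `f` by an extra factor `exp (-(t - t₀) * δ)`
compared with the monomial `α`. -/
theorem IsMonicAt.eventually_weightedNorm_sub_le {μ : σ → ℝ} (hμ : ∀ i, 0 < μ i)
    {α : σ →₀ ℕ} {f : MvPowerSeries σ ℂ} (hf : IsMonicAt μ α f) (hconv : f ∈ convergent σ) :
    ∀ᶠ t : ℝ in atTop,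
      weightedNorm (t • μ) (f - monomial α 1) ≤ 2⁻¹ * expWeight (t • μ) α := by
  classical
  obtain ⟨l, hl⟩ := hconv
  obtain ⟨t₀, ht₀⟩ := (exists_smul_ge hμ l).exists
  have hfin : weightedNorm (t₀ • μ) f < ∞ := (weightedNorm_anti ht₀ f).trans_lt hl
  -- The least of the other exponents realises the gap; if `f` is a monomial, any positive `δ` will
  -- do.
  obtain ⟨δ, hδ, hgap⟩ : ∃ δ > 0, ∀ β ≠ α, coeff β f ≠ 0 → pairing μ α + δ ≤ pairing μ β := by
    by_cases hne : {β | β ≠ α ∧ coeff β f ≠ 0}.Nonempty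
    · obtain ⟨γ, hγ, hmin⟩ := exists_pairing_minimal hμ hne
      refine ⟨pairing μ γ - pairing μ α, sub_pos.2 (hf.2 γ hγ.1 hγ.2), fun β h1 h2 => ?_⟩
      rw [add_sub_cancel]
      exact hmin β ⟨h1, h2⟩
    · refine ⟨1, one_pos, fun β h1 h2 => (hne ⟨β, h1, h2⟩).elim⟩
  have hbound : ∀ t ≥ t₀, weightedNorm (t • μ) (f - monomial α 1) ≤
      ENNReal.ofReal (Real.exp (-(t - t₀) * (pairing μ α + δ))) * weightedNorm (t₀ • μ) f := by
    intro t ht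
    rw [weightedNorm, weightedNorm, ← ENNReal.tsum_mul_left]
    refine ENNReal.tsum_le_tsum fun β => ?_
    rw [map_sub, coeff_monomial]
    by_cases hβ : β = α
    · simp [hβ, hf.1]
    rw [if_neg hβ, sub_zero]
    by_cases h0 : coeff β f = 0
    · simp [h0]
    rw [mul_left_comm]
    gcongr
    exact expWeight_smul_le ht (hgap β hβ h0)
  have hC : Tendsto (fun t : ℝ => ENNReal.ofReal (Real.exp (-(t - t₀) * δ)) *
      (ENNReal.ofReal (Real.exp (t₀ * pairing μ α)) * weightedNorm (t₀ • μ) f)) atTop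
      (𝓝 (ENNReal.ofReal 0 *
        (ENNReal.ofReal (Real.exp (t₀ * pairing μ α)) * weightedNorm (t₀ • μ) f))) := by
    refine ENNReal.Tendsto.mul_const (ENNReal.tendsto_ofReal (Real.tendsto_exp_atBot.comp ?_))
      (Or.inr (ENNReal.mul_lt_top ENNReal.ofReal_lt_top hfin).ne)
    refine Tendsto.atBot_mul_const hδ (tendsto_neg_atTop_atBot.comp ?_)
    exact tendsto_atTop_add_const_right _ _ tendsto_id
  rw [ENNReal.ofReal_zero, zero_mul] at hC
  filter_upwards [hC.eventually_le_const (u := 2⁻¹) (by simp), eventually_ge_atTop t₀]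
    with t h1 h2
  refine (hbound t h2).trans ?_
  have h3 : ENNReal.ofReal (Real.exp (-(t - t₀) * (pairing μ α + δ))) =
      ENNReal.ofReal (Real.exp (-(t - t₀) * δ)) * ENNReal.ofReal (Real.exp (t₀ * pairing μ α)) *
        expWeight (t • μ) α := by
    rw [expWeight, ← ENNReal.ofReal_mul (Real.exp_pos _).le, ← Real.exp_add,
      ← ENNReal.ofReal_mul (Real.exp_pos _).le, ← Real.exp_add, pairing_smul]
    congr 2
    ring
  rw [h3]
  calc _ = (ENNReal.ofReal (Real.exp (-(t - t₀) * δ)) *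
      (ENNReal.ofReal (Real.exp (t₀ * pairing μ α)) * weightedNorm (t₀ • μ) f)) *
      expWeight (t • μ) α := by ring
    _ ≤ _ := by gcongr

/-- The part of `e` with exponents satisfying `P`, divided by `z ^ α`. -/
def quotientPart (P : (σ →₀ ℕ) → Prop) [DecidablePred P] (α : σ →₀ ℕ) :
    MvPowerSeries σ ℂ →+ MvPowerSeries σ ℂ where
  toFun e := fun γ => if P (γ + α) then coeff (γ + α) e else 0
  map_zero' := by
    ext γ
    change (if P (γ + α) then (0 : ℂ) else 0) = 0
    simp
  map_add' a b := by
    ext γ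
    change (if P (γ + α) then coeff (γ + α) a + coeff (γ + α) b else 0) =
      (if P (γ + α) then coeff (γ + α) a else 0) + (if P (γ + α) then coeff (γ + α) b else 0)
    split_ifs <;> simp

omit [Fintype σ] in
theorem coeff_quotientPart (P : (σ →₀ ℕ) → Prop) [DecidablePred P] (α γ : σ →₀ ℕ) (e : MvPowerSeries σ ℂ) :
    coeff γ (quotientPart P α e) = if P (γ + α) then coeff (γ + α) e else 0 := rfl

theorem weightedNorm_quotientPart_mul_le (l : σ → ℝ) (P : (σ →₀ ℕ) → Prop) [DecidablePred P] (α : σ →₀ ℕ)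
    (e : MvPowerSeries σ ℂ) : weightedNorm l (quotientPart P α e) * expWeight l α ≤
      ∑' β, if P β then ‖coeff β e‖ₑ * expWeight l β else 0 := by
  rw [weightedNorm, ← ENNReal.tsum_mul_right]
  refine le_trans (le_of_eq (tsum_congr fun γ => ?_))
    (ENNReal.tsum_comp_le_tsum_of_injective (add_left_injective α) _)
  rw [coeff_quotientPart]
  split_ifs with h
  · rw [expWeight_add, mul_assoc]
  · simp

/-- Division with remainder by finitely many convergent power series whose initial exponents
are given: the remainder has no exponent divisible by one of these. -/
theorem exists_division {μ : σ → ℝ} (hμ : ∀ i, 0 < μ i) {ι : Type*} [Fintype ι]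
    (α : ι → σ →₀ ℕ) (f : ι → MvPowerSeries σ ℂ) (hf : ∀ i, IsMonicAt μ (α i) (f i))
    (hconv : ∀ i, f i ∈ convergent σ) {g : MvPowerSeries σ ℂ} (hg : g ∈ convergent σ) :
    ∃ (q : ι → MvPowerSeries σ ℂ) (r : MvPowerSeries σ ℂ), (∀ i, q i ∈ convergent σ) ∧
      r ∈ convergent σ ∧ g = ∑ i, q i * f i + r ∧ ∀ β, coeff β r ≠ 0 → ∀ i, ¬ α i ≤ β := by
  classical
  obtain ⟨l, hl⟩ := hg
  obtain ⟨t, ht, hlt⟩ := ((eventually_all.2 fun i =>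
    (hf i).eventually_weightedNorm_sub_le hμ (hconv i)).and (exists_smul_ge hμ l)).exists
  have hgt : weightedNorm (t • μ) g < ∞ := (weightedNorm_anti hlt g).trans_lt hl
  -- Several `α i` may divide `β`. Selecting one makes the pieces `Q i` and `R` of a series
  -- disjoint, so their weighted norms add up to at most that of the series.
  have hchoice : ∀ β : σ →₀ ℕ, ∃ o : Option ι, (∀ i, o = some i → α i ≤ β) ∧
      (o = none → ∀ i, ¬ α i ≤ β) := by
    intro β
    by_cases h : ∃ i, α i ≤ β
    · obtain ⟨i, hi⟩ := h
      exact ⟨some i, fun j hj => by rw [← Option.some.inj hj]; exact hi, by simp⟩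
    · exact ⟨none, by simp, fun _ i hi => h ⟨i, hi⟩⟩
  choose c hc1 hc2 using hchoice
  let Q : ι → MvPowerSeries σ ℂ →+ MvPowerSeries σ ℂ := fun i =>
    quotientPart (fun β => c β = some i) (α i)
  let R : MvPowerSeries σ ℂ →+ MvPowerSeries σ ℂ := quotientPart (fun β => c β = none) 0
  have hdecomp : ∀ e, e = ∑ i, Q i e * monomial (α i) 1 + R e := by
    intro e
    ext β
    have h1 : ∀ i, coeff β (Q i e * monomial (α i) 1) = if c β = some i then coeff β e else 0 := by
      intro i
      rw [mul_comm, coeff_monomial_mul]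
      by_cases hi : α i ≤ β
      · rw [if_pos hi, one_mul, coeff_quotientPart, tsub_add_cancel_of_le hi]
      · rw [if_neg hi, if_neg fun h => hi (hc1 β i h)]
    have h2 : coeff β (R e) = if c β = none then coeff β e else 0 := by
      rw [coeff_quotientPart, add_zero]
    rw [map_add, map_sum, h2]
    simp_rw [h1]
    rcases c β with _ | i <;> simp
  have hQ : ∀ e, ∑ i, weightedNorm (t • μ) (Q i e) * expWeight (t • μ) (α i) ≤
      weightedNorm (t • μ) e := by
    intro e
    refine (Finset.sum_le_sum fun i _ => weightedNorm_quotientPart_mul_le _ _ _ _).trans ?_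
    rw [← Summable.tsum_finsetSum fun i _ => ENNReal.summable]
    refine ENNReal.tsum_le_tsum fun β => ?_
    rcases c β with _ | i <;> simp
  have hR : ∀ e, weightedNorm (t • μ) (R e) ≤ weightedNorm (t • μ) e := by
    intro e
    have := weightedNorm_quotientPart_mul_le (t • μ) (fun β => c β = none) 0 e
    rw [expWeight_zero, mul_one] at this
    refine this.trans (ENNReal.tsum_le_tsum fun β => ?_)
    split_ifs <;> simp
  -- `hdecomp` divides by the monomials instead of the `f i`, and `S` corrects for this: if `e = g +
  -- S e`, then `g = ∑ i, Q i e * f i + R e`.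
  let S : MvPowerSeries σ ℂ →+ MvPowerSeries σ ℂ :=
    -∑ i, (AddMonoidHom.mulRight (f i - monomial (α i) 1)).comp (Q i)
  have hSapply : ∀ e, S e = -∑ i, Q i e * (f i - monomial (α i) 1) := by
    intro e
    simp [S, AddMonoidHom.finsetSum_apply]
  have hS : ∀ e, weightedNorm (t • μ) (S e) ≤ 2⁻¹ * weightedNorm (t • μ) e := by
    intro e
    rw [hSapply, weightedNorm_neg]
    refine (weightedNorm_sum_le _ _ _).trans ?_
    refine le_trans ?_ (mul_le_mul_right (hQ e) _)
    rw [Finset.mul_sum]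
    refine Finset.sum_le_sum fun i _ => (weightedNorm_mul_le _ _ _).trans ?_
    rw [mul_left_comm]
    gcongr
    exact ht i
  obtain ⟨e, he, heq⟩ := exists_eq_add_of_contraction (t • μ) S hS hgt
  refine ⟨fun i => Q i e, R e, fun i => ⟨t • μ, ?_⟩, ⟨t • μ, (hR e).trans_lt he⟩, ?_, ?_⟩
  · have h1 : weightedNorm (t • μ) (Q i e) * expWeight (t • μ) (α i) < ∞ :=
      ((Finset.single_le_sum (f := fun i => weightedNorm (t • μ) (Q i e) * expWeight (t • μ) (α i))
        (fun _ _ => zero_le) (Finset.mem_univ i)).trans (hQ e)).trans_lt he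
    exact ENNReal.lt_top_of_mul_ne_top_left h1.ne (expWeight_ne_zero _ _)
  · have h1 := hdecomp e
    rw [hSapply] at heq
    simp_rw [mul_sub, Finset.sum_sub_distrib] at heq
    linear_combination h1 - heq
  · intro β hβ
    refine hc2 β ?_
    by_contra h
    apply hβ
    rw [coeff_quotientPart, add_zero]
    exact if_neg h

theorem exists_isMonicAt {μ : σ → ℝ} (hμ : ∀ i, 0 < μ i) (hinj : Function.Injective (pairing μ))
    {f : MvPowerSeries σ ℂ} (hf : f ≠ 0) :
    ∃ α, coeff α f ≠ 0 ∧ IsMonicAt μ α (C (coeff α f)⁻¹ * f) := by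
  have hne : {α | coeff α f ≠ 0}.Nonempty := by
    by_contra h
    apply hf
    ext α
    by_contra h0
    exact h ⟨α, h0⟩
  obtain ⟨α, hα, hmin⟩ := exists_pairing_minimal hμ hne
  refine ⟨α, hα, by rw [coeff_C_mul, inv_mul_cancel₀ hα], fun β hβ h => ?_⟩
  rw [coeff_C_mul] at h
  exact (hmin β (right_ne_zero_of_mul h)).lt_of_ne fun h' => hβ (hinj h').symm

theorem C_mem_convergent (c : ℂ) : (C c : MvPowerSeries σ ℂ) ∈ convergent σ := by
  refine ⟨0, ?_⟩
  rw [← monomial_zero_eq_C_apply, weightedNorm_monomial]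
  exact ENNReal.mul_lt_top enorm_lt_top (expWeight_ne_top _ _).lt_top

/-- The ring of convergent power series in finitely many variables is Noetherian. -/
instance isNoetherianRing_convergent : IsNoetherianRing (convergent σ) := by
  classical
  refine (isNoetherianRing_iff_ideal_fg _).2 fun J => ?_
  obtain ⟨μ, hμ, hinj⟩ := exists_pairing_injective σ
  let D : (σ →₀ ℕ) → Prop := fun α => ∃ f ∈ J, IsMonicAt μ α (f : MvPowerSeries σ ℂ)
  -- Dickson's lemma: the minimal elements form an antichain in a well-quasi-order.
  have hfin : {α | Minimal D α}.Finite :=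
    WellQuasiOrderedLE.finite_of_isAntichain (setOfPred_minimal_antichain D)
  have := hfin.fintype
  choose f hfJ hf using fun α : {α | Minimal D α} => α.2.prop
  refine ⟨Finset.univ.image f, le_antisymm (Ideal.span_le.2 ?_) fun g hg => ?_⟩
  · intro x hx
    obtain ⟨α, -, rfl⟩ := Finset.mem_image.1 (Finset.mem_coe.1 hx)
    exact hfJ α
  obtain ⟨q, r, hq, hr, hgr, hrem⟩ := exists_division hμ (fun α : {α | Minimal D α} => α.1)
    (fun α => (f α : MvPowerSeries σ ℂ)) hf (fun α => (f α).2) g.2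
  have hgeq : g = ∑ α, (⟨q α, hq α⟩ : convergent σ) * f α + ⟨r, hr⟩ := by
    apply Subtype.ext
    simpa using hgr
  have hmem : ∑ α, (⟨q α, hq α⟩ : convergent σ) * f α ∈
      Ideal.span ((Finset.univ.image f : Finset (convergent σ)) : Set (convergent σ)) :=
    Ideal.sum_mem _ fun α _ => Ideal.mul_mem_left _ _ (Ideal.subset_span (by simp))
  have hrJ : (⟨r, hr⟩ : convergent σ) ∈ J := by
    rw [← add_sub_cancel_left (∑ α, (⟨q α, hq α⟩ : convergent σ) * f α) ⟨r, hr⟩, ← hgeq]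
    exact J.sub_mem hg (Ideal.sum_mem _ fun α _ => J.mul_mem_left _ (hfJ α))
  -- Otherwise the initial exponent of `r` would lie in `D`, hence above a minimal element, which
  -- the remainder excludes.
  have hr0 : r = 0 := by
    by_contra h0
    obtain ⟨β, hβ, hmon⟩ := exists_isMonicAt hμ hinj h0
    have hD : D β := by
      refine ⟨⟨C (coeff β r)⁻¹, C_mem_convergent _⟩ * ⟨r, hr⟩, J.mul_mem_left _ hrJ, ?_⟩
      rw [Subring.coe_mul]
      exact hmon
    obtain ⟨α, hα, hmin⟩ := exists_minimal_le_of_wellFoundedLT D β hD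
    exact hrem β hβ ⟨α, hmin⟩ hα
  subst hr0
  rw [hgeq]
  exact Ideal.add_mem _ hmem (Ideal.zero_mem _)

end

/-! ### Convergent power series as germs of analytic functions -/

section

open MvPowerSeries

variable {σ : Type*} [Fintype σ]

/-- The value of the monomial `z ^ α`. -/
def monomialValue (z : σ → ℂ) (α : σ →₀ ℕ) : ℂ := ∏ i, z i ^ α i

/-- The sum of the power series `a` at the point `z`. -/
def evalSeries (a : MvPowerSeries σ ℂ) (z : σ → ℂ) : ℂ := ∑' α, coeff α a * monomialValue z α

theorem monomialValue_zero (z : σ → ℂ) : monomialValue z 0 = 1 := by simp [monomialValue]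

theorem monomialValue_add (z : σ → ℂ) (α β : σ →₀ ℕ) :
    monomialValue z (α + β) = monomialValue z α * monomialValue z β := by
  simp [monomialValue, pow_add, Finset.prod_mul_distrib]

theorem monomialValue_single (z : σ → ℂ) (i : σ) :
    monomialValue z (Finsupp.single i 1) = z i := by
  rw [monomialValue, Finset.prod_eq_single i]
  · simp
  · intro j _ hj
    simp [Finsupp.single_eq_of_ne hj]
  · simp

theorem enorm_monomialValue_le {l : σ → ℝ} {z : σ → ℂ} (hz : ∀ i, ‖z i‖ ≤ Real.exp (-l i))
    (α : σ →₀ ℕ) : ‖monomialValue z α‖ₑ ≤ expWeight l α := by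
  rw [← ofReal_norm, expWeight, pairing, ← Finset.sum_neg_distrib, Real.exp_sum, monomialValue,
    norm_prod]
  refine ENNReal.ofReal_le_ofReal (Finset.prod_le_prod (fun i _ => norm_nonneg _) fun i _ => ?_)
  rw [norm_pow, ← neg_mul, mul_comm, Real.exp_nat_mul]
  exact pow_le_pow_left₀ (norm_nonneg _) (hz i) _

theorem tsum_enorm_evalSeries_lt_top {l : σ → ℝ} {z : σ → ℂ}
    (hz : ∀ i, ‖z i‖ ≤ Real.exp (-l i)) {a : MvPowerSeries σ ℂ} (ha : weightedNorm l a < ∞) :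
    ∑' α, ‖coeff α a * monomialValue z α‖ₑ < ∞ := by
  refine lt_of_le_of_lt (ENNReal.tsum_le_tsum fun α => ?_) ha
  rw [enorm_mul]
  gcongr
  exact enorm_monomialValue_le hz α

theorem hasSum_evalSeries {l : σ → ℝ} {z : σ → ℂ}
    (hz : ∀ i, ‖z i‖ ≤ Real.exp (-l i)) {a : MvPowerSeries σ ℂ} (ha : weightedNorm l a < ∞) :
    HasSum (fun α => coeff α a * monomialValue z α) (evalSeries a z) :=
  (Summable.of_enorm (tsum_enorm_evalSeries_lt_top hz ha).ne).hasSum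

theorem evalSeries_add {l : σ → ℝ} {z : σ → ℂ} (hz : ∀ i, ‖z i‖ ≤ Real.exp (-l i))
    {a b : MvPowerSeries σ ℂ} (ha : weightedNorm l a < ∞) (hb : weightedNorm l b < ∞) :
    evalSeries (a + b) z = evalSeries a z + evalSeries b z := by
  rw [evalSeries, ← ((hasSum_evalSeries hz ha).add (hasSum_evalSeries hz hb)).tsum_eq]
  simp [add_mul]

theorem evalSeries_mul {l : σ → ℝ} {z : σ → ℂ} (hz : ∀ i, ‖z i‖ ≤ Real.exp (-l i))
    {a b : MvPowerSeries σ ℂ} (ha : weightedNorm l a < ∞) (hb : weightedNorm l b < ∞) :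
    evalSeries (a * b) z = evalSeries a z * evalSeries b z := by
  classical
  have hna := tsum_enorm_ne_top_iff_summable_norm.1 (tsum_enorm_evalSeries_lt_top hz ha).ne
  have hnb := tsum_enorm_ne_top_iff_summable_norm.1 (tsum_enorm_evalSeries_lt_top hz hb).ne
  have hab : Summable fun x : (σ →₀ ℕ) × (σ →₀ ℕ) =>
      coeff x.1 a * monomialValue z x.1 * (coeff x.2 b * monomialValue z x.2) :=
    summable_mul_of_summable_norm (f := fun α => coeff α a * monomialValue z α)
      (g := fun α => coeff α b * monomialValue z α) hna hnb
  have h := Summable.tsum_mul_tsum_eq_tsum_sum_antidiagonal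
    (f := fun α => coeff α a * monomialValue z α) (g := fun α => coeff α b * monomialValue z α)
    (hasSum_evalSeries hz ha).summable (hasSum_evalSeries hz hb).summable hab
  have h2 : ∀ γ, coeff γ (a * b) * monomialValue z γ =
      ∑ x ∈ Finset.HasAntidiagonal.antidiagonal γ,
        coeff x.1 a * monomialValue z x.1 * (coeff x.2 b * monomialValue z x.2) := by
    intro γ
    rw [coeff_mul, Finset.sum_mul]
    refine Finset.sum_congr rfl fun x hx => ?_
    rw [← Finset.HasAntidiagonal.mem_antidiagonal.1 hx, monomialValue_add,
      mul_mul_mul_comm]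
  exact (tsum_congr h2).trans h.symm

theorem evalSeries_zero (z : σ → ℂ) : evalSeries 0 z = 0 := by simp [evalSeries]

theorem evalSeries_one (z : σ → ℂ) : evalSeries 1 z = 1 := by
  classical
  rw [evalSeries, tsum_eq_single 0]
  · simp [monomialValue_zero]
  · intro α hα
    simp [coeff_one, hα]

theorem eventually_norm_le_exp (l : σ → ℝ) :
    ∀ᶠ z : σ → ℂ in 𝓝 0, ∀ i, ‖z i‖ ≤ Real.exp (-l i) := by
  refine eventually_all.2 fun i => ?_
  have h : Tendsto (fun z : σ → ℂ => ‖z i‖) (𝓝 0) (𝓝 0) := by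
    have : Continuous fun z : σ → ℂ => ‖z i‖ := by fun_prop
    simpa using this.tendsto (0 : σ → ℂ)
  exact h.eventually_le_const (Real.exp_pos _)

theorem exists_constant_weight {a : MvPowerSeries σ ℂ} (ha : a ∈ convergent σ) :
    ∃ L : ℝ, weightedNorm (fun _ => L) a < ∞ := by
  obtain ⟨l, hl⟩ := ha
  obtain ⟨L, hL⟩ := Finite.exists_le l
  exact ⟨L, (weightedNorm_anti hL a).trans_lt hl⟩

theorem pairing_const (L : ℝ) (α : σ →₀ ℕ) : pairing (fun _ => L) α = α.degree * L := by
  rw [pairing, ← Finset.mul_sum, Finsupp.degree_eq_sum, mul_comm]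
  push_cast
  rfl

/-- The exponent of the product of the variables listed in a word. -/
def wordExponent {n : ℕ} (τ : Fin n → σ) : σ →₀ ℕ := ∑ j, Finsupp.single (τ j) 1

theorem monomialValue_wordExponent (z : σ → ℂ) {n : ℕ} (τ : Fin n → σ) :
    monomialValue z (wordExponent τ) = ∏ j, z (τ j) := by
  rw [wordExponent]
  induction n with
  | zero => simp [monomialValue_zero]
  | succ n ih =>
    rw [Fin.sum_univ_succ, Fin.prod_univ_succ, monomialValue_add, monomialValue_single]
    congr 1
    exact ih fun j => τ j.succ

omit [Fintype σ] in
theorem degree_wordExponent {n : ℕ} (τ : Fin n → σ) : (wordExponent τ).degree = n := by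
  simp [wordExponent]

omit [Fintype σ] in
-- Words translate between multilinear maps, which take `n` ordered arguments, and monomials of
-- degree `n`.
theorem exists_wordExponent_eq (n : ℕ) (α : σ →₀ ℕ) (hα : α.degree = n) :
    ∃ τ : Fin n → σ, wordExponent τ = α := by
  classical
  induction n generalizing α with
  | zero =>
    refine ⟨Fin.elim0, ?_⟩
    rw [(Finsupp.degree_eq_zero_iff α).1 hα]
    simp [wordExponent]
  | succ n ih =>
    obtain ⟨i, hi⟩ : ∃ i, α i ≠ 0 := by
      by_contra! h
      have : α = 0 := Finsupp.ext h
      simp [this] at hα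
    have h1 : Finsupp.single i 1 ≤ α := Finsupp.single_le_iff.2 (Nat.one_le_iff_ne_zero.2 hi)
    obtain ⟨β, rfl⟩ := exists_add_of_le h1
    rw [map_add, Finsupp.degree_single, add_comm, Nat.add_right_cancel_iff] at hα
    obtain ⟨τ, hτ⟩ := ih β hα
    refine ⟨Fin.cons i τ, ?_⟩
    rw [wordExponent, Fin.sum_univ_succ, ← hτ]
    simp [wordExponent]

theorem exists_multilinear_monomialValue (n : ℕ) (α : σ →₀ ℕ) :
    ∃ m : ContinuousMultilinearMap ℂ (fun _ : Fin n => σ → ℂ) ℂ, ‖m‖ ≤ 1 ∧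
      (α.degree = n → ∀ z, m (fun _ => z) = monomialValue z α) := by
  by_cases h : α.degree = n
  · obtain ⟨τ, hτ⟩ := exists_wordExponent_eq n α h
    refine ⟨(ContinuousMultilinearMap.mkPiAlgebra ℂ (Fin n) ℂ).compContinuousLinearMap
      fun j => ContinuousLinearMap.proj (τ j), ?_, fun _ z => ?_⟩
    · refine ContinuousMultilinearMap.opNorm_le_bound zero_le_one fun v => ?_
      rw [one_mul, ContinuousMultilinearMap.compContinuousLinearMap_apply,
        ContinuousMultilinearMap.mkPiAlgebra_apply, norm_prod]
      exact Finset.prod_le_prod (fun _ _ => norm_nonneg _) fun j _ => norm_le_pi_norm (v j) (τ j)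
    · rw [← hτ, monomialValue_wordExponent]
      simp
  · exact ⟨0, by simp, fun h' => (h h').elim⟩

theorem summable_norm_mul_pow {L : ℝ} {a : MvPowerSeries σ ℂ}
    (ha : weightedNorm (fun _ => L) a < ∞) :
    Summable fun α : σ →₀ ℕ => ‖coeff α a‖ * Real.exp (-L) ^ α.degree := by
  refine (ENNReal.summable_toReal ha.ne).congr fun α => ?_
  rw [ENNReal.toReal_mul, toReal_enorm, expWeight, ENNReal.toReal_ofReal (Real.exp_pos _).le,
    pairing_const, ← mul_neg, Real.exp_nat_mul]

theorem analyticAt_evalSeries {a : MvPowerSeries σ ℂ} (ha : a ∈ convergent σ) :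
    AnalyticAt ℂ (evalSeries a) 0 := by
  classical
  obtain ⟨L, hL⟩ := exists_constant_weight ha
  choose m hm hmz using fun n => exists_multilinear_monomialValue (σ := σ) n
  have hmem : ∀ n (α : σ →₀ ℕ), α ∈ Finset.univ.finsuppAntidiag n ↔ α.degree = n := by
    intro n α
    rw [Finset.mem_finsuppAntidiag, Finsupp.degree_eq_sum]
    simp
  -- The homogeneous part of degree `n`; the sum runs over exactly the exponents of degree `n`.
  let P : FormalMultilinearSeries ℂ (σ → ℂ) ℂ := fun n =>
    ∑ α ∈ Finset.univ.finsuppAntidiag n, coeff α a • m n α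
  have hS := summable_norm_mul_pow hL
  refine ⟨P, ENNReal.ofReal (Real.exp (-L)), ?_, by simp [Real.exp_pos], ?_⟩
  · refine P.le_radius_of_bound (∑' α : σ →₀ ℕ, ‖coeff α a‖ * Real.exp (-L) ^ α.degree) fun n => ?_
    rw [Real.coe_toNNReal _ (Real.exp_pos _).le]
    refine le_trans ?_ (hS.sum_le_tsum (Finset.univ.finsuppAntidiag n)
      fun α _ => by positivity)
    refine (mul_le_mul_of_nonneg_right (norm_sum_le _ _) (by positivity)).trans ?_
    rw [Finset.sum_mul]
    refine Finset.sum_le_sum fun α hα => ?_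
    rw [(hmem n α).1 hα, norm_smul]
    gcongr
    exact mul_le_of_le_one_right (norm_nonneg _) (hm n α)
  · intro z hz
    rw [zero_add]
    have hz' : ∀ i, ‖z i‖ ≤ Real.exp (-L) := by
      intro i
      rw [Metric.mem_eball, edist_zero_right, ← ofReal_norm,
        ENNReal.ofReal_lt_ofReal_iff (Real.exp_pos _)] at hz
      exact (norm_le_pi_norm z i).trans hz.le
    have h := (hasSum_evalSeries hz' hL).tsum_fiberwise fun α => α.degree
    convert h using 2 with n
    have hset : (fun α : σ →₀ ℕ => α.degree) ⁻¹' {n} =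
        ((Finset.univ.finsuppAntidiag n : Finset (σ →₀ ℕ)) : Set (σ →₀ ℕ)) := by
      ext α
      simp [← hmem n α]
    rw [hset, Finset.tsum_subtype' _ fun α => coeff α a * monomialValue z α]
    simp only [P]
    rw [sum_apply]
    refine Finset.sum_congr rfl fun α hα => ?_
    rw [smul_apply, hmz n α ((hmem n α).1 hα), smul_eq_mul]

/-- An analytic function is near the origin the sum of a convergent power series. -/
theorem exists_evalSeries_eq {𝕜 : Type*} [NontriviallyNormedField 𝕜] [NormedAlgebra 𝕜 ℂ]
    {F : (σ → 𝕜) → ℂ} (hF : AnalyticAt 𝕜 F 0) :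
    ∃ a ∈ convergent σ, ∀ᶠ x in 𝓝 0, F x = evalSeries a fun i => algebraMap 𝕜 ℂ (x i) := by
  classical
  obtain ⟨P, r, hP⟩ := hF
  obtain ⟨r₀, hr₀, hr₀r⟩ := ENNReal.lt_iff_exists_nnreal_btwn.1 hP.r_pos
  obtain ⟨C, hC, hbound⟩ := P.norm_mul_pow_le_of_lt_radius (hr₀r.trans_le hP.r_le)
  have hr₀' : 0 < (r₀ : ℝ) := by exact_mod_cast hr₀
  let val : (Σ n, Fin n → σ) → ℂ := fun s => P s.1 fun j => Pi.single (s.2 j) 1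
  let cnt : (Σ n, Fin n → σ) → σ →₀ ℕ := fun s => wordExponent s.2
  -- Expanding `P n` on basis vectors gives one term per word; the coefficient at `α` collects the
  -- words with exponent `α`.
  let a : MvPowerSeries σ ℂ := fun α => ∑' s : cnt ⁻¹' {α}, val s
  have hval : ∀ s, ‖val s‖ ≤ ‖P s.1‖ := by
    intro s
    refine ((P s.1).le_opNorm _).trans ?_
    refine mul_le_of_le_one_right (norm_nonneg _) (Finset.prod_le_one (fun _ _ => norm_nonneg _)
      fun j _ => ?_)
    refine (pi_norm_le_iff_of_nonneg zero_le_one).2 fun i => ?_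
    by_cases h : i = s.2 j
    · subst h
      simp
    · simp [Pi.single_eq_of_ne h]
  -- There are at most `K ^ n` words of length `n`, so the radius `ε = r₀ / (2 * K)` bounds their
  -- total contribution by `C * 2⁻¹ ^ n`. The `+ 1` keeps `K` positive when `σ` is empty.
  let K : ℝ := Fintype.card σ + 1
  have hK : 0 < K := by positivity
  let ε : ℝ := r₀ / (2 * K)
  have hε : 0 < ε := by positivity
  let l : σ → ℝ := fun _ => -Real.log ε
  have hl : ∀ i, Real.exp (-l i) = ε := fun i => by simp [l, Real.exp_log hε]
  have hweight : ∀ s, expWeight l (cnt s) = ENNReal.ofReal (ε ^ s.1) := by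
    intro s
    rw [expWeight, pairing_const, degree_wordExponent, neg_mul_eq_mul_neg, neg_neg,
      Real.exp_nat_mul, Real.exp_log hε]
  have hfin : ∑' s, ‖val s‖ₑ * expWeight l (cnt s) < ∞ := by
    rw [ENNReal.tsum_sigma']
    calc ∑' (n : ℕ) (τ : Fin n → σ), ‖val ⟨n, τ⟩‖ₑ * expWeight l (cnt ⟨n, τ⟩)
        ≤ ∑' n : ℕ, ENNReal.ofReal C * 2⁻¹ ^ n := by
          refine ENNReal.tsum_le_tsum fun n => ?_
          rw [tsum_fintype]
          have h1 : ∀ τ : Fin n → σ, ‖val ⟨n, τ⟩‖ₑ * expWeight l (cnt ⟨n, τ⟩) ≤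
              ENNReal.ofReal (‖P n‖ * ε ^ n) := by
            intro τ
            rw [hweight, ← ofReal_norm, ← ENNReal.ofReal_mul (norm_nonneg _)]
            refine ENNReal.ofReal_le_ofReal ?_
            gcongr
            exact hval ⟨n, τ⟩
          refine (Finset.sum_le_sum fun τ _ => h1 τ).trans ?_
          rw [Finset.sum_const, Finset.card_univ, Fintype.card_fun, Fintype.card_fin,
            nsmul_eq_mul, ← ENNReal.ofReal_natCast, ← ENNReal.ofReal_mul (Nat.cast_nonneg _)]
          have h2 : (2⁻¹ : ℝ≥0∞) = ENNReal.ofReal 2⁻¹ := by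
            rw [ENNReal.ofReal_inv_of_pos two_pos]
            simp
          rw [h2, ← ENNReal.ofReal_pow (by norm_num), ← ENNReal.ofReal_mul hC.le]
          refine ENNReal.ofReal_le_ofReal ?_
          calc ((Fintype.card σ ^ n : ℕ) : ℝ) * (‖P n‖ * ε ^ n)
              ≤ K ^ n * (‖P n‖ * ε ^ n) := by
                push_cast
                gcongr
                simp [K]
            _ = (‖P n‖ * r₀ ^ n) * 2⁻¹ ^ n := by
                have : (r₀ : ℝ) = 2 * K * ε := by simp only [ε]; field_simp
                rw [this, mul_pow, mul_pow, inv_pow]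
                field_simp
            _ ≤ C * 2⁻¹ ^ n := by gcongr; exact hbound n
      _ < ∞ := by
          rw [ENNReal.tsum_mul_left, ENNReal.tsum_geometric, ENNReal.one_sub_inv_two, inv_inv]
          exact ENNReal.mul_lt_top ENNReal.ofReal_lt_top (by simp)
  have ha : weightedNorm l a < ∞ := by
    refine lt_of_le_of_lt ?_ hfin
    rw [← ENNReal.tsum_fiberwise _ cnt, weightedNorm]
    refine ENNReal.tsum_le_tsum fun α => ?_
    refine (mul_le_mul_left enorm_tsum_le_tsum_enorm _).trans ?_
    rw [← ENNReal.tsum_mul_right]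
    refine ENNReal.tsum_le_tsum fun s => ?_
    rw [show cnt s = α from s.2]
  refine ⟨a, ⟨l, ha⟩, ?_⟩
  have hnhds : ∀ᶠ x : σ → 𝕜 in 𝓝 0, ∀ i, ‖algebraMap 𝕜 ℂ (x i)‖ ≤ Real.exp (-l i) := by
    have hcont : Continuous fun (x : σ → 𝕜) i => algebraMap 𝕜 ℂ (x i) := by
      have := continuous_algebraMap 𝕜 ℂ
      fun_prop
    have h0 := hcont.tendsto 0
    simp only [Pi.zero_apply, map_zero] at h0
    exact h0.eventually (eventually_norm_le_exp l)
  filter_upwards [hnhds, Metric.eball_mem_nhds 0 hP.r_pos] with x hx hxr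
  have hsum : Summable fun s => val s * monomialValue (fun i => algebraMap 𝕜 ℂ (x i)) (cnt s) := by
    refine Summable.of_enorm (lt_of_le_of_lt (ENNReal.tsum_le_tsum fun s => ?_) hfin).ne
    rw [enorm_mul]
    gcongr
    exact enorm_monomialValue_le hx _
  -- The same absolutely convergent sum over words, grouped by exponent here and by length in `h2`.
  have h1 := hsum.hasSum.tsum_fiberwise cnt
  have h2 : HasSum (fun n => P n fun _ => x)
      (∑' s, val s * monomialValue (fun i => algebraMap 𝕜 ℂ (x i)) (cnt s)) := by
    refine hsum.hasSum.sigma fun n => ?_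
    have hx' : P n (fun _ => x) = ∑ τ : Fin n → σ,
        val ⟨n, τ⟩ * monomialValue (fun i => algebraMap 𝕜 ℂ (x i)) (cnt ⟨n, τ⟩) := by
      have hx1 : x = ∑ i, x i • (Pi.single i 1 : σ → 𝕜) := by
        ext j
        simp [Finset.sum_apply, Pi.single_apply]
      conv_lhs => rw [hx1]
      rw [ContinuousMultilinearMap.map_sum]
      refine Finset.sum_congr rfl fun τ _ => ?_
      rw [ContinuousMultilinearMap.map_smul_univ, monomialValue_wordExponent, Algebra.smul_def,
        map_prod, mul_comm]
    rw [hx']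
    exact hasSum_fintype _
  have h3 := hP.hasSum hxr
  rw [zero_add] at h3
  rw [h3.unique h2, ← h1.tsum_eq, evalSeries]
  refine tsum_congr fun α => ?_
  change _ = (∑' s : cnt ⁻¹' {α}, val s) * _
  rw [← tsum_mul_right]
  refine tsum_congr fun s => ?_
  rw [show cnt s = α from s.2]

end

/-! ### Grönwall's inequality, straightening of submersions, evaluation identities -/

section

/-- A function whose derivative in the direction `v` is bounded by a multiple of the function
vanishes at `x + v` if it vanishes at `x`. -/
theorem eq_zero_of_norm_fderiv_le {E V : Type*} [NormedAddCommGroup E] [NormedSpace ℂ E]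
    [NormedAddCommGroup V] [NormedSpace ℂ V] {G : E → V} {s : Set E} (hs : Convex ℝ s)
    (hG : ∀ y ∈ s, DifferentiableAt ℂ G y) {v : E} {K : ℝ}
    (hK : ∀ y ∈ s, ‖fderiv ℂ G y v‖ ≤ K * ‖G y‖) {x : E} (hx : x ∈ s) (hxv : x + v ∈ s)
    (h0 : G x = 0) : G (x + v) = 0 := by
  have hmem : ∀ t ∈ Set.Icc (0 : ℝ) 1, x + t • v ∈ s := fun t ht => hs.add_smul_mem hx hxv ht
  have hderiv : ∀ t ∈ Set.Icc (0 : ℝ) 1,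
      HasDerivAt (fun t : ℝ => G (x + t • v)) (fderiv ℂ G (x + t • v) v) t := by
    intro t ht
    have h1 : HasDerivAt (fun t : ℝ => x + t • v) v t := by
      simpa using ((hasDerivAt_id t).smul_const v).const_add x
    exact ((hG _ (hmem t ht)).hasFDerivAt.restrictScalars ℝ).comp_hasDerivAt t h1
  -- Grönwall's inequality for `G` on the real segment from `x` to `x + v`.
  have h := eq_zero_of_abs_deriv_le_mul_abs_self_of_eq_zero_right (K := K)
    (fun t ht => (hderiv t ht).continuousAt.continuousWithinAt)
    (fun t ht => (hderiv t (Set.Ico_subset_Icc_self ht)).hasDerivWithinAt)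
    (by simpa using h0) (fun t ht => hK _ (hmem t (Set.Ico_subset_Icc_self ht))) 1 (by simp)
  simpa using h

/-- An analytic submersion is near a point the first component of an analytic chart. -/
theorem exists_analytic_straightening {E F : Type*} [NormedAddCommGroup E] [NormedSpace ℂ E]
    [CompleteSpace E] [NormedAddCommGroup F] [NormedSpace ℂ F] [FiniteDimensional ℂ F]
    {f : E → F} {f' : E →L[ℂ] F} {a : E} (hf : AnalyticAt ℂ f a) (hf' : HasFDerivAt f f' a)
    (hsurj : (f' : E →ₗ[ℂ] F).range = ⊤) :
    ∃ Φ : OpenPartialHomeomorph E (F × (f' : E →ₗ[ℂ] F).ker), a ∈ Φ.source ∧ AnalyticAt ℂ Φ a ∧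
      AnalyticAt ℂ Φ.symm (Φ a) ∧ (∀ x, (Φ x).1 = f x) ∧ (Φ a).2 = 0 := by
  have : CompleteSpace F := FiniteDimensional.complete ℂ F
  have hstrict : HasStrictFDerivAt f f' a := by
    have := hf.hasStrictFDerivAt
    rwa [hf'.fderiv] at this
  let φ := hstrict.implicitFunctionDataOfComplemented f f' hsurj
    f'.ker_closedComplemented_of_finiteDimensional_range
  have hφa : φ.pt = a := rfl
  have hfun : ∀ x, φ.toOpenPartialHomeomorph x = (f x, φ.rightDeriv (x - a)) := fun x => rfl
  have han : AnalyticAt ℂ φ.toOpenPartialHomeomorph a := by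
    have h1 : AnalyticAt ℂ (fun x => (f x, φ.rightDeriv (x - a))) a := by
      refine hf.prod ((φ.rightDeriv.analyticAt _).comp ?_)
      exact analyticAt_id.sub analyticAt_const
    exact h1
  refine ⟨φ.toOpenPartialHomeomorph, φ.pt_mem_toOpenPartialHomeomorph_source, han, ?_,
    fun x => rfl, ?_⟩
  · exact φ.toOpenPartialHomeomorph.analyticAt_symm' φ.pt_mem_toOpenPartialHomeomorph_source han
      φ.hasStrictFDerivAt.hasFDerivAt.fderiv
  · rw [hfun]
    simp

theorem eventually_evalSeries_add {σ : Type*} [Fintype σ] {a b : MvPowerSeries σ ℂ}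
    (ha : a ∈ convergent σ) (hb : b ∈ convergent σ) :
    ∀ᶠ z in 𝓝 0, evalSeries (a + b) z = evalSeries a z + evalSeries b z := by
  obtain ⟨l, hl⟩ := ha
  obtain ⟨l', hl'⟩ := hb
  filter_upwards [eventually_norm_le_exp (l ⊔ l')] with z hz
  exact evalSeries_add hz ((weightedNorm_anti le_sup_left a).trans_lt hl)
    ((weightedNorm_anti le_sup_right b).trans_lt hl')

theorem eventually_evalSeries_mul {σ : Type*} [Fintype σ] {a b : MvPowerSeries σ ℂ}
    (ha : a ∈ convergent σ) (hb : b ∈ convergent σ) :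
    ∀ᶠ z in 𝓝 0, evalSeries (a * b) z = evalSeries a z * evalSeries b z := by
  obtain ⟨l, hl⟩ := ha
  obtain ⟨l', hl'⟩ := hb
  filter_upwards [eventually_norm_le_exp (l ⊔ l')] with z hz
  exact evalSeries_mul hz ((weightedNorm_anti le_sup_left a).trans_lt hl)
    ((weightedNorm_anti le_sup_right b).trans_lt hl')

theorem eventually_evalSeries_sum_mul {σ ι : Type*} [Fintype σ] (s : Finset ι)
    (c g : ι → convergent σ) :
    ∀ᶠ z in 𝓝 0, evalSeries (∑ i ∈ s, c i * g i : convergent σ) z =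
      ∑ i ∈ s, evalSeries (c i : MvPowerSeries σ ℂ) z * evalSeries (g i : MvPowerSeries σ ℂ) z := by
  classical
  induction s using Finset.induction_on with
  | empty => simp [evalSeries_zero]
  | insert i s hi ih =>
    rw [Finset.sum_insert hi]
    filter_upwards [ih, eventually_evalSeries_add (c i * g i).2 (∑ i ∈ s, c i * g i).2,
      eventually_evalSeries_mul (c i).2 (g i).2] with z h1 h2 h3
    rw [Finset.sum_insert hi, ← h1, ← h3]
    exact h2

end

/-! ### Complexification of `ℂ^N` at a point -/

section

variable {N : ℕ}

/-- The real linear map `v ↦ (Re v, Im v)` into the complexification of `ℂ^N`. -/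
def complexifyLinear (N : ℕ) : (Fin N → ℂ) →L[ℝ] (Fin N ⊕ Fin N → ℂ) :=
  ContinuousLinearMap.pi (Sum.elim
    (fun k => Complex.ofRealCLM ∘L Complex.reCLM ∘L ContinuousLinearMap.proj k)
    (fun k => Complex.ofRealCLM ∘L Complex.imCLM ∘L ContinuousLinearMap.proj k))

/-- The embedding of `ℂ^N` in its complexification, centred at `p`. -/
def complexify (p q : Fin N → ℂ) : Fin N ⊕ Fin N → ℂ := complexifyLinear N (q - p)

/-- The complex linear extension of the identity of `ℂ^N` to the complexification. -/
def holomorphicCoord (N : ℕ) : (Fin N ⊕ Fin N → ℂ) →L[ℂ] (Fin N → ℂ) :=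
  ContinuousLinearMap.pi fun k => ContinuousLinearMap.proj (Sum.inl k) +
    Complex.I • ContinuousLinearMap.proj (Sum.inr k)

/-- The vector of the complexification that represents `∂/∂z̄_k`. -/
def dzbarVector (k : Fin N) : Fin N ⊕ Fin N → ℂ :=
  (1 / 2 : ℂ) • (Pi.single (Sum.inl k) 1 + Complex.I • Pi.single (Sum.inr k) 1)

theorem complexifyLinear_inl (v : Fin N → ℂ) (k : Fin N) :
    complexifyLinear N v (Sum.inl k) = ((v k).re : ℂ) := rfl

theorem complexifyLinear_inr (v : Fin N → ℂ) (k : Fin N) :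
    complexifyLinear N v (Sum.inr k) = ((v k).im : ℂ) := rfl

theorem holomorphicCoord_apply (u : Fin N ⊕ Fin N → ℂ) (k : Fin N) :
    holomorphicCoord N u k = u (Sum.inl k) + Complex.I * u (Sum.inr k) := rfl

theorem complexifyLinear_single_one (k : Fin N) :
    complexifyLinear N (Pi.single k 1) = Pi.single (Sum.inl k) 1 := by
  ext (j | j)
  · by_cases h : j = k
    · subst h
      simp [complexifyLinear_inl]
    · simp [complexifyLinear_inl, h]
  · by_cases h : j = k
    · subst h
      simp [complexifyLinear_inr]
    · simp [complexifyLinear_inr, h]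

theorem complexifyLinear_single_I (k : Fin N) :
    complexifyLinear N (Pi.single k Complex.I) = Pi.single (Sum.inr k) 1 := by
  ext (j | j)
  · by_cases h : j = k
    · subst h
      simp [complexifyLinear_inl]
    · simp [complexifyLinear_inl, h]
  · by_cases h : j = k
    · subst h
      simp [complexifyLinear_inr]
    · simp [complexifyLinear_inr, h]

theorem holomorphicCoord_complexify (p q : Fin N → ℂ) :
    holomorphicCoord N (complexify p q) = q - p := by
  ext k
  rw [holomorphicCoord_apply, complexify, complexifyLinear_inl, complexifyLinear_inr, mul_comm]
  exact Complex.re_add_im _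

theorem complexify_self (p : Fin N → ℂ) : complexify p p = 0 := by
  rw [complexify, sub_self, map_zero]

/-- On the kernel the `inr` components are determined by the `inl` components. The factor `2`
cancels the `1 / 2` in `dzbarVector`, and it reappears in the coefficients of the CR fields below.
-/
theorem eq_sum_dzbarVector {u : Fin N ⊕ Fin N → ℂ} (hu : holomorphicCoord N u = 0) :
    ∑ k, (2 * u (Sum.inl k)) • dzbarVector k = u := by
  have h : ∀ k, u (Sum.inl k) = -(Complex.I * u (Sum.inr k)) := fun k =>
    eq_neg_of_add_eq_zero_left (congrFun hu k)
  ext (j | j)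
  · simp [dzbarVector, Finset.sum_apply, Pi.single_apply]
    ring
  · simp [dzbarVector, Finset.sum_apply, Pi.single_apply, h]
    linear_combination -u (Sum.inr j) * Complex.I_mul_I

theorem holomorphicCoord_dzbarVector (k : Fin N) : holomorphicCoord N (dzbarVector k) = 0 := by
  ext j
  by_cases h : j = k
  · subst h
    simp [holomorphicCoord_apply, dzbarVector]
    linear_combination (1 / 2 : ℂ) * Complex.I_mul_I
  · simp [holomorphicCoord_apply, dzbarVector, h]

theorem hasFDerivAt_complexify (p q : Fin N → ℂ) :
    HasFDerivAt (complexify p) (complexifyLinear N) q :=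
  (complexifyLinear N).hasFDerivAt.comp q ((hasFDerivAt_id q).sub_const p)

theorem analyticAt_complexify (p q : Fin N → ℂ) : AnalyticAt ℝ (complexify p) q :=
  ((complexifyLinear N).analyticAt _).comp (analyticAt_id.sub analyticAt_const)

theorem continuous_complexify (p : Fin N → ℂ) : Continuous (complexify p) :=
  (complexifyLinear N).continuous.comp (continuous_id.sub continuous_const)

theorem tendsto_complexify (p : Fin N → ℂ) : Tendsto (complexify p) (𝓝 p) (𝓝 0) := by
  have := (continuous_complexify p).tendsto p
  rwa [complexify_self] at this

theorem analyticAt_comp_complexify {V : Type*} [NormedAddCommGroup V] [NormedSpace ℂ V]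
    {p q : Fin N → ℂ} {h : (Fin N ⊕ Fin N → ℂ) → V} (hh : AnalyticAt ℂ h (complexify p q)) :
    AnalyticAt ℝ (fun q => h (complexify p q)) q :=
  (hh.restrictScalars (𝕜 := ℝ)).comp (analyticAt_complexify p q)

theorem fderiv_of_eventuallyEq_comp_complexify {p q : Fin N → ℂ} {F : (Fin N → ℂ) → ℂ}
    {h : (Fin N ⊕ Fin N → ℂ) → ℂ} (hh : DifferentiableAt ℂ h (complexify p q))
    (hF : F =ᶠ[𝓝 q] fun q => h (complexify p q)) (v : Fin N → ℂ) :
    fderiv ℝ F q v = fderiv ℂ h (complexify p q) (complexifyLinear N v) := by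
  have h1 : HasFDerivAt (fun q => h (complexify p q))
      (((fderiv ℂ h (complexify p q)).restrictScalars ℝ).comp (complexifyLinear N)) q :=
    (hh.hasFDerivAt.restrictScalars ℝ).comp q (hasFDerivAt_complexify p q)
  rw [hF.fderiv_eq, h1.fderiv]
  rfl

theorem dzbar_of_eventuallyEq_comp_complexify {p q : Fin N → ℂ} {F : (Fin N → ℂ) → ℂ}
    {h : (Fin N ⊕ Fin N → ℂ) → ℂ} (hh : DifferentiableAt ℂ h (complexify p q))
    (hF : F =ᶠ[𝓝 q] fun q => h (complexify p q)) (k : Fin N) :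
    dzbar k F q = fderiv ℂ h (complexify p q) (dzbarVector k) := by
  rw [dzbar, fderiv_of_eventuallyEq_comp_complexify hh hF,
    fderiv_of_eventuallyEq_comp_complexify hh hF, complexifyLinear_single_one,
    complexifyLinear_single_I, dzbarVector, map_smul, map_add, map_smul, smul_eq_mul, smul_eq_mul]

theorem applyField_of_eventuallyEq_comp_complexify {p q : Fin N → ℂ} {F : (Fin N → ℂ) → ℂ}
    {h : (Fin N ⊕ Fin N → ℂ) → ℂ} (hh : DifferentiableAt ℂ h (complexify p q))
    (hF : F =ᶠ[𝓝 q] fun q => h (complexify p q)) {u : Fin N ⊕ Fin N → ℂ}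
    (hu : holomorphicCoord N u = 0) {a : (Fin N → ℂ) → Fin N → ℂ}
    (ha : ∀ k, a q k = 2 * u (Sum.inl k)) :
    applyField a F q = fderiv ℂ h (complexify p q) u := by
  conv_rhs => rw [← eq_sum_dzbarVector hu]
  rw [applyField, map_sum]
  refine Finset.sum_congr rfl fun k _ => ?_
  rw [dzbar_of_eventuallyEq_comp_complexify hh hF, ha, map_smul, smul_eq_mul]

/-- A real-analytic function is near a point the restriction of a convergent power series on the
complexification. -/
theorem exists_evalSeries_complexify {p : Fin N → ℂ} {F : (Fin N → ℂ) → ℂ}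
    (hF : AnalyticAt ℝ F p) :
    ∃ a ∈ convergent (Fin N ⊕ Fin N), ∀ᶠ q in 𝓝 p, F q = evalSeries a (complexify p q) := by
  -- `p + r` inverts the real coordinates `c`; the power series is the Taylor expansion of `F (p + r
  -- x)` in `2N` real variables.
  let r : (Fin N ⊕ Fin N → ℝ) →L[ℝ] (Fin N → ℂ) := ContinuousLinearMap.pi fun k =>
    Complex.ofRealCLM ∘L ContinuousLinearMap.proj (Sum.inl k) +
      Complex.I • (Complex.ofRealCLM ∘L ContinuousLinearMap.proj (Sum.inr k))
  let c : (Fin N → ℂ) → Fin N ⊕ Fin N → ℝ := fun q =>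
    Sum.elim (fun k => (q k - p k).re) fun k => (q k - p k).im
  have hc : ∀ q i, ((c q i : ℝ) : ℂ) = complexify p q i := by
    rintro q (k | k) <;> rfl
  have hcc : Continuous c := by
    refine continuous_pi ?_
    rintro (k | k)
    · exact Complex.continuous_re.comp (by fun_prop)
    · exact Complex.continuous_im.comp (by fun_prop)
  have hcp : c p = 0 := by
    ext (k | k) <;> simp [c]
  have hrc : ∀ q, p + r (c q) = q := by
    intro q
    ext k
    have : r (c q) k = ((q k - p k).re : ℂ) + Complex.I * ((q k - p k).im : ℂ) := rfl
    rw [Pi.add_apply, this, mul_comm, Complex.re_add_im]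
    ring
  have hFr : AnalyticAt ℝ (fun x => F (p + r x)) 0 := by
    refine AnalyticAt.comp (g := F) (f := fun x => p + r x) ?_
      (analyticAt_const.add (r.analyticAt 0))
    simpa using hF
  obtain ⟨a, ha, hev⟩ := exists_evalSeries_eq hFr
  refine ⟨a, ha, ?_⟩
  have ht : Tendsto c (𝓝 p) (𝓝 0) := by
    have := hcc.tendsto p
    rwa [hcp] at this
  filter_upwards [ht.eventually hev] with q hq
  rw [hrc] at hq
  rw [hq]
  congr 1
  ext i
  exact hc q i

theorem analyticAt_evalSeries_complexify (p : Fin N → ℂ) (a : convergent (Fin N ⊕ Fin N)) :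
    AnalyticAt ℝ (fun q => evalSeries (a : MvPowerSeries (Fin N ⊕ Fin N) ℂ) (complexify p q)) p :=
  analyticAt_comp_complexify (by rw [complexify_self]; exact analyticAt_evalSeries a.2)

/-- The germ along `M` of the sum of a convergent power series on the complexification. -/
def evalGerm (M : Set (Fin N → ℂ)) (p : Fin N → ℂ) :
    convergent (Fin N ⊕ Fin N) →+* analyticGerms M p where
  toFun a := restrict M (fun q => evalSeries (a : MvPowerSeries (Fin N ⊕ Fin N) ℂ) (complexify p q))
    (analyticAt_evalSeries_complexify p a)
  map_one' := Subtype.ext (congrArg (fun F : (Fin N → ℂ) → ℂ => (F : Germ (𝓝[M] p) ℂ))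
    (funext fun _ => evalSeries_one _))
  map_zero' := Subtype.ext (congrArg (fun F : (Fin N → ℂ) → ℂ => (F : Germ (𝓝[M] p) ℂ))
    (funext fun _ => evalSeries_zero _))
  map_add' a b := Subtype.ext (Germ.coe_eq.2 (eventually_nhdsWithin_of_eventually_nhds
    ((tendsto_complexify p).eventually (eventually_evalSeries_add a.2 b.2))))
  map_mul' a b := Subtype.ext (Germ.coe_eq.2 (eventually_nhdsWithin_of_eventually_nhds
    ((tendsto_complexify p).eventually (eventually_evalSeries_mul a.2 b.2))))

theorem restrict_eq_restrict {M : Set (Fin N → ℂ)} {p : Fin N → ℂ} {F G : (Fin N → ℂ) → ℂ}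
    {hF : AnalyticAt ℝ F p} {hG : AnalyticAt ℝ G p} (h : F =ᶠ[𝓝 p] G) :
    restrict M F hF = restrict M G hG :=
  Subtype.ext (Germ.coe_eq.2 (eventually_nhdsWithin_of_eventually_nhds h))

/-- Surjectivity recovers an ideal of germs from its preimage, so that generators upstairs give
generators of `I`. -/
theorem evalGerm_surjective (M : Set (Fin N → ℂ)) (p : Fin N → ℂ) :
    Function.Surjective (evalGerm M p) := by
  rintro ⟨_, F, hF, rfl⟩
  obtain ⟨a, ha, h⟩ := exists_evalSeries_complexify hF
  exact ⟨⟨a, ha⟩, (restrict_eq_restrict (hF := hF) (hG := hF.congr h) h).symm⟩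

theorem IsZeroLocus.congr {M : Set (Fin N → ℂ)} {p : Fin N → ℂ} {I : Ideal (analyticGerms M p)}
    {A B : Set (Fin N → ℂ)} (hA : IsZeroLocus I A) (h : ∀ᶠ q in 𝓝 p, q ∈ A ↔ q ∈ B) :
    IsZeroLocus I B := by
  refine ⟨⟨?_, fun F hF hFI => ?_⟩, fun C hC => ?_⟩
  · filter_upwards [hA.1.1, h] with q h1 h2 hq using h1 (h2.2 hq)
  · filter_upwards [hA.1.2 F hF hFI, h] with q h1 h2 hq using h1 (h2.2 hq)
  · filter_upwards [hA.2 C hC, h] with q h1 h2 hq using h2.1 (h1 hq)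

/-- Directional derivatives of a real function are real. This carries the independence of the `∂ρ_j`
over to the `∂̄ρ_j`. -/
theorem dzbar_ofReal {p : Fin N → ℂ} {r : (Fin N → ℂ) → ℝ} (hr : DifferentiableAt ℝ r p)
    (k : Fin N) : dzbar k (fun q => (r q : ℂ)) p =
      starRingEnd ℂ (dz k (fun q => (r q : ℂ)) p) := by
  have h : ∀ v, fderiv ℝ (fun q => (r q : ℂ)) p v = ((fderiv ℝ r p v : ℝ) : ℂ) := by
    intro v
    have h1 : HasFDerivAt (fun q => (r q : ℂ)) (Complex.ofRealCLM.comp (fderiv ℝ r p)) p :=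
      Complex.ofRealCLM.hasFDerivAt.comp p hr.hasFDerivAt
    rw [h1.fderiv]
    rfl
  simp [dzbar, dz, h, Complex.conj_ofNat]

/-- The differentials `∂̄ρ_1, …, ∂̄ρ_d` of a generic defining map are independent, so that they take
arbitrary values. -/
theorem IsGenericDefiningMapAt.exists_dzbar_eq {d : ℕ} {M : Set (Fin N → ℂ)} {p : Fin N → ℂ}
    {ρ : (Fin N → ℂ) → Fin d → ℝ} (hρ : IsGenericDefiningMapAt M p ρ) (r : Fin d → ℂ) :
    ∃ c : Fin N → ℂ, ∀ j, ∑ k, c k * dzbar k (fun q => ((ρ q j : ℝ) : ℂ)) p = r j := by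
  let B : Matrix (Fin d) (Fin N) ℂ := fun j k => dzbar k (fun q => ((ρ q j : ℝ) : ℂ)) p
  have hB : ∀ j k, B j k = starRingEnd ℂ (dz k (fun q => ((ρ q j : ℝ) : ℂ)) p) := fun j k =>
    dzbar_ofReal (analyticAt_pi_iff.1 hρ.analyticAt j).differentiableAt k
  have hli : LinearIndependent ℂ B.row := by
    rw [Fintype.linearIndependent_iff]
    intro c hc j
    have h1 := Fintype.linearIndependent_iff.1 hρ.linearIndependent (fun j => starRingEnd ℂ (c j)) ?_ j
    · simpa using h1
    · ext k
      have h2 := congrArg (starRingEnd ℂ) (congrFun hc k)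
      simpa [Finset.sum_apply, hB, Matrix.row] using h2
  have hrank := hli.rank_matrix
  have htop : B.mulVecLin.range = ⊤ := by
    apply Submodule.eq_top_of_finrank_eq
    rw [Module.finrank_fin_fun]
    simpa [Matrix.rank] using hrank
  obtain ⟨c, hc⟩ := LinearMap.range_eq_top.1 htop r
  refine ⟨c, fun j => ?_⟩
  rw [← hc, Matrix.mulVecLin_apply, Matrix.mulVec, dotProduct]
  exact Finset.sum_congr rfl fun k _ => mul_comm _ _

end

/-! ### Fibres of the complexified submanifold and the subvariety -/

section

variable {N : ℕ}

theorem analyticAt_clm_apply {E F G : Type*} [NormedAddCommGroup E] [NormedSpace ℂ E]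
    [NormedAddCommGroup F] [NormedSpace ℂ F] [NormedAddCommGroup G] [NormedSpace ℂ G]
    {A : E → F →L[ℂ] G} {u : E → F} {x : E} (hA : AnalyticAt ℂ A x) (hu : AnalyticAt ℂ u x) :
    AnalyticAt ℂ (fun x => A x (u x)) x :=
  AnalyticAt.comp (g := fun y : (F →L[ℂ] G) × F => y.1 y.2) (f := fun x => (A x, u x))
    ((ContinuousLinearMap.id ℂ (F →L[ℂ] G)).analyticAt_bilinear (A x, u x)) (hA.prod hu)

/-- The map whose components are the holomorphic coordinates and the complexified defining map of a
generic submanifold is a submersion. -/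
theorem IsGenericDefiningMapAt.range_eq_top {d : ℕ} {M : Set (Fin N → ℂ)} {p : Fin N → ℂ}
    {ρ : (Fin N → ℂ) → Fin d → ℝ} (hρ : IsGenericDefiningMapAt M p ρ)
    {R : (Fin N ⊕ Fin N → ℂ) → Fin d → ℂ} (hR : DifferentiableAt ℂ R 0)
    (hRρ : ∀ᶠ q in 𝓝 p, ∀ j, ((ρ q j : ℝ) : ℂ) = R (complexify p q) j) :
    (((holomorphicCoord N).prod (fderiv ℂ R 0) : (Fin N ⊕ Fin N → ℂ) →L[ℂ] _) :
      (Fin N ⊕ Fin N → ℂ) →ₗ[ℂ] (Fin N → ℂ) × (Fin d → ℂ)).range = ⊤ := by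
  rw [LinearMap.range_eq_top]
  rintro ⟨z, r⟩
  -- A lift of `z`. Adding vectors `dzbarVector k` does not change its image under
  -- `holomorphicCoord`, while by genericity they adjust the other component arbitrarily.
  let u₀ : Fin N ⊕ Fin N → ℂ := Sum.elim z 0
  obtain ⟨c, hc⟩ := hρ.exists_dzbar_eq (r - fderiv ℂ R 0 u₀)
  have hRj : ∀ j, HasFDerivAt (fun x => R x j)
      ((ContinuousLinearMap.proj j).comp (fderiv ℂ R 0)) 0 := fun j =>
    (hasFDerivAt_pi'.1 hR.hasFDerivAt) j
  have hdz : ∀ j k, dzbar k (fun q => ((ρ q j : ℝ) : ℂ)) p = fderiv ℂ R 0 (dzbarVector k) j := by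
    intro j k
    have h1 := dzbar_of_eventuallyEq_comp_complexify (p := p) (q := p) (h := fun x => R x j)
      (by rw [complexify_self]; exact (hRj j).differentiableAt)
      (hRρ.mono fun q hq => hq j) k
    rw [h1, complexify_self, (hRj j).fderiv]
    rfl
  refine ⟨u₀ + ∑ k, c k • dzbarVector k, Prod.ext ?_ ?_⟩
  · change holomorphicCoord N (u₀ + ∑ k, c k • dzbarVector k) = z
    rw [map_add, map_sum]
    simp only [map_smul, holomorphicCoord_dzbarVector, smul_zero, Finset.sum_const_zero, add_zero]
    ext k
    simp [holomorphicCoord_apply, u₀]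
  · change fderiv ℂ R 0 (u₀ + ∑ k, c k • dzbarVector k) = r
    rw [map_add, map_sum]
    ext j
    have := hc j
    simp only [hdz, Pi.sub_apply] at this
    simp [Finset.sum_apply, this]

/-- Analytic families of vector fields along the fibres of the first component of a chart. -/
theorem eventually_fderiv_fst_chart_eq_zero {E F Y : Type*} [NormedAddCommGroup E]
    [NormedSpace ℂ E] [NormedAddCommGroup F] [NormedSpace ℂ F]
    [NormedAddCommGroup Y] [NormedSpace ℂ Y] [CompleteSpace E] {f : E → F}
    [CompleteSpace F] {Φ : OpenPartialHomeomorph E (F × Y)} {a : E} (ha : a ∈ Φ.source)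
    (hf : AnalyticAt ℂ f a) (hΦ' : AnalyticAt ℂ Φ.symm (Φ a)) (hfst : ∀ x, (Φ x).1 = f x) :
    ∀ᶠ x in 𝓝 a, ∀ v : Y, fderiv ℂ f x (fderiv ℂ Φ.symm (Φ x) (0, v)) = 0 := by
  have hcont : ContinuousAt Φ a := Φ.continuousAt ha
  filter_upwards [Φ.open_source.mem_nhds ha, hf.eventually_analyticAt,
    hcont.eventually hΦ'.eventually_analyticAt] with x hx hfx hΦx v
  have h1 : HasFDerivAt (fun y => f (Φ.symm y))
      ((fderiv ℂ f x).comp (fderiv ℂ Φ.symm (Φ x))) (Φ x) := by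
    refine HasFDerivAt.comp (Φ x) ?_ hΦx.differentiableAt.hasFDerivAt
    rw [Φ.left_inv hx]
    exact hfx.differentiableAt.hasFDerivAt
  -- In the chart `f` is the first projection, whose derivative kills `(0, v)`.
  have h2 : HasFDerivAt (fun y => f (Φ.symm y)) (ContinuousLinearMap.fst ℂ F Y) (Φ x) := by
    refine hasFDerivAt_fst.congr_of_eventuallyEq ?_
    filter_upwards [Φ.open_target.mem_nhds (Φ.map_source hx)] with y hy
    rw [← hfst, Φ.right_inv hy]
  have h3 := congrArg (fun A : (F × Y) →L[ℂ] F => A (0, v)) (h1.unique h2)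
  simpa using h3

/-- A complex analytic vector field on the complexification that is tangent to the complexified
submanifold and annihilates the holomorphic coordinates restricts to a CR vector field. -/
theorem isCRVectorFieldAt_of_tangent {d : ℕ} {M : Set (Fin N → ℂ)} {p : Fin N → ℂ}
    {ρ : (Fin N → ℂ) → Fin d → ℝ} (hρ : IsGenericDefiningMapAt M p ρ)
    {R : (Fin N ⊕ Fin N → ℂ) → Fin d → ℂ} (hR : AnalyticAt ℂ R 0)
    (hRρ : ∀ᶠ q in 𝓝 p, ∀ j, ((ρ q j : ℝ) : ℂ) = R (complexify p q) j)
    {u : (Fin N ⊕ Fin N → ℂ) → Fin N ⊕ Fin N → ℂ} (hu : AnalyticAt ℂ u 0)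
    (huZ : ∀ᶠ x in 𝓝 0, holomorphicCoord N (u x) = 0)
    (huR : ∀ᶠ x in 𝓝 0, fderiv ℂ R x (u x) = 0) :
    IsCRVectorFieldAt d M p fun q k => 2 * u (complexify p q) (Sum.inl k) := by
  refine ⟨?_, ρ, hρ, eventually_nhdsWithin_of_eventually_nhds ?_⟩
  · have hu' : AnalyticAt ℝ (fun q => u (complexify p q)) p :=
      analyticAt_comp_complexify (by rwa [complexify_self])
    exact analyticAt_pi_iff.2 fun k => analyticAt_const.mul (analyticAt_pi_iff.1 hu' _)
  · filter_upwards [hRρ.eventually_nhds, (tendsto_complexify p).eventually huZ,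
      (tendsto_complexify p).eventually huR,
      (tendsto_complexify p).eventually hR.eventually_analyticAt] with q h1 h2 h3 h4 j
    have hRj : HasFDerivAt (fun x => R x j)
        ((ContinuousLinearMap.proj j).comp (fderiv ℂ R (complexify p q))) (complexify p q) :=
      (hasFDerivAt_pi'.1 h4.differentiableAt.hasFDerivAt) j
    rw [applyField_of_eventuallyEq_comp_complexify (h := fun x => R x j) hRj.differentiableAt
      (h1.mono fun q hq => hq j) h2 fun k => rfl, hRj.fderiv]
    change fderiv ℂ R (complexify p q) (u (complexify p q)) j = 0
    rw [h3]
    rfl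

/-- Derivatives of generators of a `∂̄_b`-closed ideal along tangent fields are combinations of the
generators, on a full neighbourhood in the complexification. -/
theorem eventually_fderiv_eq_sum {d m : ℕ} {M : Set (Fin N → ℂ)} {p : Fin N → ℂ}
    {I : Ideal (analyticGerms M p)} (hI : IsDbarClosed d I)
    {g : Fin m → convergent (Fin N ⊕ Fin N)}
    (hg : Ideal.span (Set.range g) = I.comap (evalGerm M p))
    {u : (Fin N ⊕ Fin N → ℂ) → Fin N ⊕ Fin N → ℂ} (hu : AnalyticAt ℂ u 0)
    (huZ : ∀ᶠ x in 𝓝 0, holomorphicCoord N (u x) = 0)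
    (huCR : IsCRVectorFieldAt d M p fun q k => 2 * u (complexify p q) (Sum.inl k)) (i : Fin m) :
    ∃ c : Fin m → convergent (Fin N ⊕ Fin N), ∀ᶠ x in 𝓝 0,
      fderiv ℂ (evalSeries (g i : MvPowerSeries (Fin N ⊕ Fin N) ℂ)) x (u x) =
        ∑ j, evalSeries (c j : MvPowerSeries (Fin N ⊕ Fin N) ℂ) x *
          evalSeries (g j : MvPowerSeries (Fin N ⊕ Fin N) ℂ) x := by
  have hgan := analyticAt_evalSeries (g i).2
  have hD : AnalyticAt ℂ
      (fun x => fderiv ℂ (evalSeries (g i : MvPowerSeries (Fin N ⊕ Fin N) ℂ)) x (u x)) 0 :=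
    analyticAt_clm_apply hgan.fderiv hu
  obtain ⟨b, hb, hbD⟩ := exists_evalSeries_eq hD
  simp only [Algebra.algebraMap_self, RingHom.id_apply] at hbD
  have hgI : evalGerm M p (g i) ∈ I := by
    have h1 : g i ∈ I.comap (evalGerm M p) := hg ▸ Ideal.subset_span ⟨i, rfl⟩
    exact h1
  have hLI := hI _ huCR _ (analyticAt_evalSeries_complexify p (g i)) hgI
  have hbI : evalGerm M p ⟨b, hb⟩ ∈ I := by
    refine Eq.mp (congrArg (· ∈ I) (restrict_eq_restrict
      (hG := analyticAt_evalSeries_complexify p ⟨b, hb⟩) ?_)) hLI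
    filter_upwards [(tendsto_complexify p).eventually hbD, (tendsto_complexify p).eventually huZ,
      (tendsto_complexify p).eventually hgan.eventually_analyticAt] with q h1 h2 h3
    rw [applyField_of_eventuallyEq_comp_complexify h3.differentiableAt (Eventually.of_forall
      fun _ => rfl) h2 fun k => rfl, h1]
  -- The preimage of `I` contains the kernel of `evalGerm`, so information along `M` alone yields an
  -- identity of power series, valid off `M` too.
  have hbJ : (⟨b, hb⟩ : convergent (Fin N ⊕ Fin N)) ∈ Ideal.span (Set.range g) := by
    rw [hg]
    exact hbI
  obtain ⟨c, hc⟩ := Ideal.mem_span_range_iff_exists_fun.1 hbJ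
  refine ⟨c, ?_⟩
  filter_upwards [hbD, eventually_evalSeries_sum_mul Finset.univ c g] with x h1 h2
  rw [h1, ← h2, hc]

/-- In a chart straightening the fibres, the vector of generators of a `∂̄_b`-closed ideal satisfies a
differential inequality along the fibres, so that its zero set is a union of fibres. -/
theorem exists_convex_nhds_zero_iff {E F Y : Type*} {m : ℕ} [NormedAddCommGroup E]
    [NormedSpace ℂ E] [NormedAddCommGroup F] [NormedSpace ℂ F] [NormedAddCommGroup Y]
    [NormedSpace ℂ Y] [CompleteSpace E] [FiniteDimensional ℂ Y]
    {Φ : OpenPartialHomeomorph E (F × Y)} {a : E} (ha : a ∈ Φ.source)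
    (hΦ' : AnalyticAt ℂ Φ.symm (Φ a)) {g : Fin m → E → ℂ} (hg : ∀ i, AnalyticAt ℂ (g i) a)
    (hfd : ∀ (v : Y) (i : Fin m), ∃ c : Fin m → E → ℂ, (∀ j, ContinuousAt (c j) a) ∧
      ∀ᶠ x in 𝓝 a, fderiv ℂ (g i) x (fderiv ℂ Φ.symm (Φ x) (0, v)) = ∑ j, c j x * g j x) :
    ∃ ε > 0, (∀ y ∈ Metric.ball (Φ a) ε, ∀ i, AnalyticAt ℂ (fun y => g i (Φ.symm y)) y) ∧
      ∀ w k k', (w, k) ∈ Metric.ball (Φ a) ε → (w, k') ∈ Metric.ball (Φ a) ε →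
        (∀ i, g i (Φ.symm (w, k)) = 0) → ∀ i, g i (Φ.symm (w, k')) = 0 := by
  let G : F × Y → Fin m → ℂ := fun y i => g i (Φ.symm y)
  let b := Module.finBasis ℂ Y
  have hsymm : Tendsto Φ.symm (𝓝 (Φ a)) (𝓝 a) := by
    have := Φ.continuousAt_symm (Φ.map_source ha)
    rwa [ContinuousAt, Φ.left_inv ha] at this
  have hGan : ∀ᶠ y in 𝓝 (Φ a), ∀ i, AnalyticAt ℂ (fun y => g i (Φ.symm y)) y := by
    refine eventually_all.2 fun i => ?_
    filter_upwards [hsymm.eventually (hg i).eventually_analyticAt, hΦ'.eventually_analyticAt]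
      with y h1 h2 using h1.comp h2
  -- Each direction has its own coefficients and neighbourhood; restricting to a finite basis gives
  -- a common ball for all directions.
  have hbound : ∀ l, ∃ K, ∀ᶠ y in 𝓝 (Φ a), ‖fderiv ℂ G y (0, b l)‖ ≤ K * ‖G y‖ := by
    intro l
    choose c hc hcg using hfd (b l)
    refine ⟨∑ i, ∑ j, (‖c i j a‖ + 1), ?_⟩
    have hcb : ∀ᶠ x in 𝓝 a, ∀ i j, ‖c i j x‖ ≤ ‖c i j a‖ + 1 :=
      eventually_all.2 fun i => eventually_all.2 fun j =>
        (hc i j).norm.eventually_le_const (lt_add_one _)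
    filter_upwards [hGan, hsymm.eventually hcb, hsymm.eventually (eventually_all.2 hcg),
      Φ.open_target.mem_nhds (Φ.map_source ha), hΦ'.eventually_analyticAt,
      hsymm.eventually (eventually_all.2 fun i => (hg i).eventually_analyticAt)]
      with y h1 h2 h3 h4 h5 h6
    have hd : ∀ i, HasFDerivAt (fun y => G y i)
        ((fderiv ℂ (g i) (Φ.symm y)).comp (fderiv ℂ Φ.symm y)) y := fun i =>
      ((h6 i).differentiableAt.hasFDerivAt).comp y h5.differentiableAt.hasFDerivAt
    have hK : 0 ≤ ∑ i, ∑ j, (‖c i j a‖ + 1) :=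
      Finset.sum_nonneg fun i _ => Finset.sum_nonneg fun j _ => by positivity
    refine (pi_norm_le_iff_of_nonneg (by positivity)).2 fun i => ?_
    have h7 : fderiv ℂ G y (0, b l) i =
        fderiv ℂ (g i) (Φ.symm y) (fderiv ℂ Φ.symm y (0, b l)) := by
      rw [(hasFDerivAt_pi.2 hd).fderiv]
      rfl
    have h8 := h3 i
    rw [Φ.right_inv h4] at h8
    rw [h7, h8]
    calc ‖∑ j, c i j (Φ.symm y) * g j (Φ.symm y)‖
        ≤ ∑ j, (‖c i j a‖ + 1) * ‖G y‖ := by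
          refine (norm_sum_le _ _).trans (Finset.sum_le_sum fun j _ => ?_)
          rw [norm_mul]
          exact mul_le_mul (h2 i j) (norm_le_pi_norm (G y) j) (norm_nonneg _) (by positivity)
      _ = (∑ j, (‖c i j a‖ + 1)) * ‖G y‖ := by rw [Finset.sum_mul]
      _ ≤ _ := by
          refine mul_le_mul_of_nonneg_right ?_ (norm_nonneg _)
          exact Finset.single_le_sum (f := fun i => ∑ j, (‖c i j a‖ + 1))
            (fun i _ => Finset.sum_nonneg fun j _ => by positivity) (Finset.mem_univ i)
  choose K hK using hbound
  obtain ⟨ε, hε, hball⟩ := Metric.eventually_nhds_iff_ball.1 (hGan.and (eventually_all.2 hK))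
  refine ⟨ε, hε, fun y hy => (hball y hy).1, fun w k k' hk hk' h0 => ?_⟩
  have hGd : ∀ y ∈ Metric.ball (Φ a) ε, DifferentiableAt ℂ G y := fun y hy =>
    differentiableAt_pi.2 fun i => ((hball y hy).1 i).differentiableAt
  have hdir : ∀ y ∈ Metric.ball (Φ a) ε, ‖fderiv ℂ G y (0, k' - k)‖ ≤
      (∑ l, ‖b.repr (k' - k) l‖ * K l) * ‖G y‖ := by
    intro y hy
    have h1 : ((0, k' - k) : F × Y) = ∑ l, b.repr (k' - k) l • ((0, b l) : F × Y) := by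
      refine Prod.ext ?_ ?_
      · simp [Prod.fst_sum]
      · simp only [Prod.snd_sum, Prod.smul_snd, b.sum_repr]
    rw [h1, map_sum, Finset.sum_mul]
    refine (norm_sum_le _ _).trans (Finset.sum_le_sum fun l _ => ?_)
    rw [map_smul, norm_smul, mul_assoc]
    gcongr
    exact (hball y hy).2 l
  have hadd : ((w, k) : F × Y) + (0, k' - k) = (w, k') := by simp
  have := eq_zero_of_norm_fderiv_le (convex_ball _ _) hGd hdir hk (by rwa [hadd]) (funext h0)
  rw [hadd] at this
  exact fun i => congrFun this i

/-- The generators need not be holomorphic in `q`, but their common vanishing is constant along the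
fibres of `(Z, R)` in a ball of the chart. Testing it on a holomorphic section instead of on `M`
gives holomorphic equations for the same germ. -/
theorem exists_subvariety_isZeroLocus {d : ℕ} {M : Set (Fin N → ℂ)} {p : Fin N → ℂ}
    {ρ : (Fin N → ℂ) → Fin d → ℝ} (hp : p ∈ M) (hρ : IsGenericDefiningMapAt M p ρ)
    {I : Ideal (analyticGerms M p)} (hI : IsDbarClosed d I) :
    ∃ U V : Set (Fin N → ℂ), IsOpen U ∧ p ∈ U ∧ IsComplexSubvariety U V ∧
      IsZeroLocus I (V ∩ M) := by
  choose r hr hrρ using fun j => exists_evalSeries_complexify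
    (Complex.ofRealCLM.analyticAt _ |>.comp (analyticAt_pi_iff.1 hρ.analyticAt j))
  let R : (Fin N ⊕ Fin N → ℂ) → Fin d → ℂ := fun x j => evalSeries (r j) x
  have hR : AnalyticAt ℂ R 0 := analyticAt_pi_iff.2 fun j => analyticAt_evalSeries (hr j)
  have hRρ : ∀ᶠ q in 𝓝 p, ∀ j, ((ρ q j : ℝ) : ℂ) = R (complexify p q) j :=
    eventually_all.2 hrρ
  have hρp : ρ p = 0 := hρ.mem_iff.self_of_nhds.1 hp
  have hR0 : R 0 = 0 := by
    ext j
    have := hRρ.self_of_nhds j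
    rw [complexify_self, hρp] at this
    simpa using this.symm
  let f : (Fin N ⊕ Fin N → ℂ) → (Fin N → ℂ) × (Fin d → ℂ) := fun x => (holomorphicCoord N x, R x)
  have hf : AnalyticAt ℂ f 0 := ((holomorphicCoord N).analyticAt _).prod hR
  have hf' : ∀ x, AnalyticAt ℂ R x →
      HasFDerivAt f ((holomorphicCoord N).prod (fderiv ℂ R x)) x := fun x hx =>
    (holomorphicCoord N).hasFDerivAt.prodMk hx.differentiableAt.hasFDerivAt
  obtain ⟨Φ, h0, hΦ, hΦ', hfst, hsnd⟩ := exists_analytic_straightening hf (hf' 0 hR)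
    (hρ.range_eq_top hR.differentiableAt hRρ)
  have hΦ0 : Φ 0 = ((0, 0), 0) := by
    refine Prod.ext ?_ hsnd
    rw [hfst]
    simp [f, hR0]
  have hfib := eventually_fderiv_fst_chart_eq_zero h0 hf hΦ' hfst
  obtain ⟨m, g, hg⟩ := Submodule.fg_iff_exists_fin_generating_family.1
    ((isNoetherianRing_iff_ideal_fg _).1 isNoetherianRing_convergent (I.comap (evalGerm M p)))
  change Ideal.span (Set.range g) = _ at hg
  have hgan : ∀ i, AnalyticAt ℂ (evalSeries (g i : MvPowerSeries (Fin N ⊕ Fin N) ℂ)) 0 :=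
    fun i => analyticAt_evalSeries (g i).2
  obtain ⟨ε, hε, han, hzero⟩ := exists_convex_nhds_zero_iff h0 hΦ' hgan fun v i => by
    have hu : AnalyticAt ℂ (fun x => fderiv ℂ Φ.symm (Φ x) (0, v)) 0 :=
      analyticAt_clm_apply (hΦ'.fderiv.comp hΦ) analyticAt_const
    have hfu : ∀ᶠ x in 𝓝 0, holomorphicCoord N (fderiv ℂ Φ.symm (Φ x) (0, v)) = 0 ∧
        fderiv ℂ R x (fderiv ℂ Φ.symm (Φ x) (0, v)) = 0 := by
      filter_upwards [hfib, hR.eventually_analyticAt] with x h1 h2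
      have h3 := h1 v
      rw [(hf' x h2).fderiv] at h3
      exact Prod.ext_iff.1 h3
    obtain ⟨c, hc⟩ := eventually_fderiv_eq_sum hI hg hu (hfu.mono fun _ h => h.1)
      (isCRVectorFieldAt_of_tangent hρ hR hRρ hu (hfu.mono fun _ h => h.1)
        (hfu.mono fun _ h => h.2)) i
    exact ⟨fun j => evalSeries (c j : MvPowerSeries (Fin N ⊕ Fin N) ℂ),
      fun j => (analyticAt_evalSeries (c j).2).continuousAt, hc⟩
  have hspan : I = Ideal.span (Set.range fun i => evalGerm M p (g i)) := by
    rw [← Ideal.map_comap_of_surjective _ (evalGerm_surjective M p) I, ← hg, Ideal.map_span,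
      ← Set.range_comp]
    rfl
  have hlocus : IsZeroLocus I {q | q ∈ M ∧ ∀ i,
      evalSeries (g i : MvPowerSeries (Fin N ⊕ Fin N) ℂ) (complexify p q) = 0} := by
    rw [hspan]
    exact isZeroLocus_of_span _ fun i => analyticAt_evalSeries_complexify p (g i)
  -- The section, in the chart: over `(z - p, 0)` choose the point with fibre coordinate `0`.
  let s : (Fin N → ℂ) → ((Fin N → ℂ) × (Fin d → ℂ)) ×
      (((holomorphicCoord N).prod (fderiv ℂ R 0) : (Fin N ⊕ Fin N → ℂ) →L[ℂ] _) :
      (Fin N ⊕ Fin N → ℂ) →ₗ[ℂ] (Fin N → ℂ) × (Fin d → ℂ)).ker := fun z => ((z - p, 0), 0)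
  have hs : ∀ z, AnalyticAt ℂ s z := fun z =>
    ((analyticAt_id.sub analyticAt_const).prod analyticAt_const).prod analyticAt_const
  have hsc : Continuous s := continuous_iff_continuousAt.2 fun z => (hs z).continuousAt
  have hsp : s p = Φ 0 := by
    rw [hΦ0]
    simp [s]
  let U : Set (Fin N → ℂ) := s ⁻¹' Metric.ball (Φ 0) ε
  have hU : IsOpen U := Metric.isOpen_ball.preimage hsc
  have hpU : p ∈ U := by
    rw [Set.mem_preimage, hsp]
    exact Metric.mem_ball_self hε
  refine ⟨U, {z | z ∈ U ∧ ∀ i, evalSeries (g i : MvPowerSeries (Fin N ⊕ Fin N) ℂ)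
    (Φ.symm (s z)) = 0}, hU, hpU, ⟨fun z hz => hz.1, fun z hz => ?_⟩, hlocus.congr ?_⟩
  · refine ⟨m, fun i z => evalSeries (g i : MvPowerSeries (Fin N ⊕ Fin N) ℂ) (Φ.symm (s z)),
      fun i => (han (s z) hz i).comp (hs z), ?_⟩
    filter_upwards [hU.mem_nhds hz] with z' hz'
    exact and_iff_right hz'
  · have hΦt : Tendsto (fun q => Φ (complexify p q)) (𝓝 p) (𝓝 (Φ 0)) :=
      (Φ.continuousAt h0).tendsto.comp (tendsto_complexify p)
    filter_upwards [hρ.mem_iff, hRρ, (tendsto_complexify p).eventually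
      (Φ.open_source.mem_nhds h0), hΦt.eventually (Metric.ball_mem_nhds _ hε),
      hU.mem_nhds hpU] with q h1 h2 h3 h4 h5
    change (q ∈ M ∧ _) ↔ ((q ∈ U ∧ _) ∧ q ∈ M)
    rw [and_comm, and_congr_left_iff]
    intro hqM
    rw [and_iff_right h5]
    have hRq : R (complexify p q) = 0 := by
      ext j
      rw [← h2 j, h1.1 hqM]
      simp
    have hfq : (Φ (complexify p q)).1 = (q - p, 0) := by
      rw [hfst]
      simp only [f]
      rw [holomorphicCoord_complexify, hRq]
    have hmem : ((q - p, 0), (Φ (complexify p q)).2) ∈ Metric.ball (Φ 0) ε := by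
      rw [← hfq]
      exact h4
    have hΦq : Φ.symm ((q - p, 0), (Φ (complexify p q)).2) = complexify p q := by
      rw [← hfq]
      exact Φ.left_inv h3
    -- The image of `q` and the section point lie over the same `(q - p, 0)`, both in the ball;
    -- vanishing passes in either direction.
    constructor
    · intro h
      refine hzero _ _ _ hmem h5 ?_
      rwa [hΦq]
    · intro h
      have := hzero _ _ _ h5 hmem h
      rwa [hΦq] at this

end

end CRGerm

end

theorem mainTheorem6 (n d : ℕ) (M : Set (Fin (n + d) → ℂ))
    (hM : CRGerm.IsGenericSubmanifold d M) (p : Fin (n + d) → ℂ) (hp : p ∈ M)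
    (I : Ideal (CRGerm.analyticGerms M p)) (hI : CRGerm.IsDbarClosed d I) :
    ∃ U V : Set (Fin (n + d) → ℂ), IsOpen U ∧ p ∈ U ∧ CRGerm.IsComplexSubvariety U V ∧
      CRGerm.IsZeroLocus I (V ∩ M) := by
  obtain ⟨ρ, hρ⟩ := hM p hp
  exact CRGerm.exists_subvariety_isZeroLocus hp hρ hI
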